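/- **Proposition 5.6.** Let $0<L<2\pi$, let $\mathbb T^2=\mathbb R^2/(L\mathbb Z)^2$, and for $k\in\mathbb Z^2$ put $\lambda_k=(2\pi/L)^2(k_1^2+k_2^2)-1$ (so $\lambda_0=-1$ and $\lambda_k>0$ for $k\neq0$), $|k|=\max\{|k_1|,|k_2|\}$, $e_k(x)=L^{-1}\mathrm e^{\mathrm i(2\pi/L)k\cdot x}$. For $N\in\mathbb N$ and $\varepsilon>0$, consider real fields $\phi_N=\sum_{|k|\le N}z_ke_k$ with $z_k\in\mathbb C$, $z_{-k}=\overline{z_k}$; the space of such $z$ is identified isometrically (for $\sum_k|z_k|^2$) with $\mathbb R^{(2N+1)^2}$, which fixes gradients and Lebesgue measure $\mathrm dz$. Write $z=(z_0,z_\perp)$ with $z_0\in\mathbb R$ and $z_\perp=(z_k)_{0<|k|\le N}$. Let $$V_N(z)=\frac12\int_{\mathbb T^2}\bigl(\|\nabla\phi_N\|^2-\phi_N^2\bigr)\,\mathrm dx+\frac14\int_{\mathbb T^2}\bigl(\phi_N^4-6\varepsilon C_N\phi_N^2+3\varepsilon^2C_N^2\bigr)\,\mathrm dx,\qquad C_N=\frac1{L^2}\sum_{|k|\le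 N}\frac1{|\lambda_k|}.$$ For measurable $A,B\subset\mathbb R^{(2N+1)^2}$ let $$\operatorname{cap}_A(B)=\varepsilon\inf_h\int_{(A\cup B)^c}\|\nabla h(z)\|^2\,\mathrm e^{-V_N(z)/\varepsilon}\,\mathrm dz,$$ the infimum being over all $h$ in the Sobolev space $H^1(\mathbb R^{(2N+1)^2},\mathrm e^{-V_N/\varepsilon}\mathrm dz)$ with $h=1$ in $A$ and $h=0$ in $B$ almost everywhere. Let $\gamma_0^\perp$ be the Gaussian probability measure on the space of the transversal coordinates $y_\perp=(y_k)_{0<|k|\le N}$ with density proportional to $\exp\bigl(-\frac12\sum_{0<|k|\le N}\lambda_k|y_k|^2\bigr)$. Fix $\delta\in(0,1)$. There exists a constant $c_->0$, depending only on $L$ and $\delta$, such that for all $\varepsilon>0$, all $N\in\mathbb N$ and all measurable sets $D_\perp\subset A_\perp$ of transversal coordinates, the sets $$A=\{z:\ z_0/L\in[-1-\delta,-1+\delta],\ z_\perp\in A_\perp\},\qquad B=\{z:\ z_0/L\in[1-\delta,1+\delta],\ z_\perp\in A_\perp\}$$ satisfy $$\operatorname{cap}_A(B)\ \ge\ \sqrt{\frac{\varepsilon|\lambda_0|}{2\pi}}\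 \prod_{0<|k|\le N}\sqrt{\frac{2\pi\varepsilon}{\lambda_k}}\ \Bigl[\mathbb P^{\gamma_0^\perp}\bigl(\hat D_\perp\bigr)-c_-\sqrt\varepsilon\,\Bigr],\qquad \hat D_\perp=D_\perp/\sqrt\varepsilon .$$ -/

import Mathlib

open scoped Pointwise ENNReal

namespace AllenCahn

noncomputable section

/-! ### Fourier modes and coordinates -/

/-- The eigenvalue `λ_k = (2π/L)² (k₁² + k₂²) - 1` of `-Δ - 1` on the torus of size `L`. -/
def eigenvalue (L : ℝ) (k : ℤ × ℤ) : ℝ :=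
  (2 * Real.pi / L) ^ 2 * ((k.1 : ℝ) ^ 2 + (k.2 : ℝ) ^ 2) - 1

/-- The wave vectors `k ∈ ℤ²` with `max |k₁| |k₂| ≤ N`. -/
def modes (N : ℕ) : Finset (ℤ × ℤ) :=
  Finset.Icc (-(N : ℤ)) N ×ˢ Finset.Icc (-(N : ℤ)) N

/-- The wave vectors with `0 < max |k₁| |k₂| ≤ N`. -/
def nonzeroModes (N : ℕ) : Finset (ℤ × ℤ) := (modes N).erase 0

theorem zero_mem_modes (N : ℕ) : (0 : ℤ × ℤ) ∈ modes N := by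
  simp [modes]

theorem neg_mem_modes {N : ℕ} {k : ℤ × ℤ} (hk : k ∈ modes N) : -k ∈ modes N := by
  simp only [modes, Finset.mem_product, Finset.mem_Icc, Prod.fst_neg, Prod.snd_neg] at hk ⊢
  omega

/-- The state space `ℝ^((2N+1)²)`: one real coordinate for each wave vector. -/
abbrev Space (N : ℕ) : Type := EuclideanSpace ℝ (modes N)

/-- The space of the transversal coordinates, indexed by the nonzero wave vectors. -/
abbrev PerpSpace (N : ℕ) : Type := EuclideanSpace ℝ (nonzeroModes N)

/-- The coordinate `z₀` (mean mode). -/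
def zeroCoord {N : ℕ} (z : Space N) : ℝ := z ⟨0, zero_mem_modes N⟩

/-- The transversal part `z_⊥` of `z`. -/
def perpPart {N : ℕ} (z : Space N) : PerpSpace N :=
  WithLp.toLp 2 fun k => z ⟨k.1, Finset.mem_of_mem_erase k.2⟩

/-- The field on the torus (seen as an `L`-periodic function on `ℝ²`) with real coordinates `z`,
`φ(x) = ∑_k z_k L⁻¹ (cos (2π k·x/L) + sin (2π k·x/L))`. The functions
`L⁻¹ (cos (2π k·x/L) + sin (2π k·x/L))` form an orthonormal system of real functions in `L²` of the
torus, with the same span as the complex exponentials; see `field_eq_sum_fourier`. -/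
def field (L : ℝ) {N : ℕ} (z : Space N) (x₁ x₂ : ℝ) : ℝ :=
  ∑ k : modes N, z k * (L⁻¹ *
    (Real.cos (2 * Real.pi / L * ((k.1.1 : ℝ) * x₁ + (k.1.2 : ℝ) * x₂)) +
      Real.sin (2 * Real.pi / L * ((k.1.1 : ℝ) * x₁ + (k.1.2 : ℝ) * x₂))))

/-! The next four facts document that the real coordinates are an isometric
parametrisation of the complex Fourier coefficients `z_k` with `z_{-k} = conj z_k`. -/

/-- The normalised complex Fourier basis function `e_k(x) = L⁻¹ exp(i (2π/L) k·x)`. -/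
def fourierBasis (L : ℝ) (k : ℤ × ℤ) (x₁ x₂ : ℝ) : ℂ :=
  (L : ℂ)⁻¹ * Complex.exp
    (((2 * Real.pi / L * ((k.1 : ℝ) * x₁ + (k.2 : ℝ) * x₂) : ℝ) : ℂ) * Complex.I)

/-- The wave vector `-k`. -/
def negMode {N : ℕ} (k : modes N) : modes N := ⟨-k.1, neg_mem_modes k.2⟩

theorem negMode_negMode {N : ℕ} (k : modes N) : negMode (negMode k) = k := by
  ext <;> simp [negMode]

/-- The complex Fourier coefficient with wave vector `k` of the field with coordinates `z`. -/
def fourierCoeff {N : ℕ} (z : Space N) (k : modes N) : ℂ :=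
  ((1 - Complex.I) * (z k : ℂ) + (1 + Complex.I) * (z (negMode k) : ℂ)) / 2

theorem fourierCoeff_negMode {N : ℕ} (z : Space N) (k : modes N) :
    fourierCoeff z (negMode k) = (starRingEnd ℂ) (fourierCoeff z k) := by
  simp only [fourierCoeff, negMode_negMode, map_div₀, map_add, map_mul, map_sub, map_one,
    Complex.conj_I, Complex.conj_ofReal, map_ofNat]
  ring

theorem sum_negMode {M : Type*} [AddCommMonoid M] {N : ℕ} (f : modes N → M) :
    ∑ k, f (negMode k) = ∑ k, f k :=
  Equiv.sum_comp (⟨negMode, negMode, negMode_negMode, negMode_negMode⟩ : modes N ≃ modes N) f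

theorem field_eq_sum_fourier (L : ℝ) {N : ℕ} (z : Space N) (x₁ x₂ : ℝ) :
    (field L z x₁ x₂ : ℂ) = ∑ k : modes N, fourierCoeff z k * fourierBasis L k.1 x₁ x₂ := by
  have h : ∑ k : modes N, (1 + Complex.I) * (z (negMode k) : ℂ) / 2 * fourierBasis L k.1 x₁ x₂ =
      ∑ k : modes N, (1 + Complex.I) * (z k : ℂ) / 2 * fourierBasis L (-k.1) x₁ x₂ := by
    rw [← sum_negMode]
    simp only [negMode_negMode]
    rfl
  have h2 : ∑ k : modes N, fourierCoeff z k * fourierBasis L k.1 x₁ x₂ =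
      ∑ k : modes N, ((1 - Complex.I) * (z k : ℂ) / 2 * fourierBasis L k.1 x₁ x₂ +
        (1 + Complex.I) * (z k : ℂ) / 2 * fourierBasis L (-k.1) x₁ x₂) := by
    rw [Finset.sum_add_distrib, ← h, ← Finset.sum_add_distrib]
    refine Finset.sum_congr rfl fun k _ => ?_
    simp only [fourierCoeff]
    ring
  rw [h2, field, Complex.ofReal_sum]
  refine Finset.sum_congr rfl fun k _ => ?_
  have hneg : ((2 * Real.pi / L * (((-k.1).1 : ℝ) * x₁ + ((-k.1).2 : ℝ) * x₂) : ℝ) : ℂ) =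
      -((2 * Real.pi / L * ((k.1.1 : ℝ) * x₁ + (k.1.2 : ℝ) * x₂) : ℝ) : ℂ) := by
    rw [← Complex.ofReal_neg]
    congr 1
    push_cast [Prod.fst_neg, Prod.snd_neg]
    ring
  simp only [fourierBasis, hneg, Complex.exp_mul_I, Complex.cos_neg, Complex.sin_neg]
  rw [Complex.ofReal_mul, Complex.ofReal_mul, Complex.ofReal_add, Complex.ofReal_cos,
    Complex.ofReal_sin, Complex.ofReal_inv]
  linear_combination (-((z k : ℂ) * (L : ℂ)⁻¹ * Complex.sin
    ((2 * Real.pi / L * ((k.1.1 : ℝ) * x₁ + (k.1.2 : ℝ) * x₂) : ℝ) : ℂ))) * (-Complex.I_sq)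

theorem sum_weight_fourierCoeff {N : ℕ} (z : Space N) (w : ℤ × ℤ → ℝ) (hw : ∀ k, w (-k) = w k) :
    ∑ k : modes N, w k.1 * ‖fourierCoeff z k‖ ^ 2 = ∑ k : modes N, w k.1 * z k ^ 2 := by
  have h1 : ∀ k : modes N, w k.1 * ‖fourierCoeff z k‖ ^ 2 =
      (w k.1 * z k ^ 2) / 2 + (w (negMode k).1 * z (negMode k) ^ 2) / 2 := by
    intro k
    have hk : w (negMode k).1 = w k.1 := hw k.1
    rw [hk, ← Complex.normSq_eq_norm_sq, Complex.normSq_apply]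
    simp [fourierCoeff]
    ring
  simp only [h1]
  rw [Finset.sum_add_distrib, sum_negMode fun k : modes N => (w k.1 * z k ^ 2) / 2,
    ← Finset.sum_add_distrib]
  exact Finset.sum_congr rfl fun k _ => by ring

/-! ### The renormalised potential -/

/-- The renormalisation constant `C_N = L⁻² ∑_{|k| ≤ N} 1/|λ_k|`. -/
def renormConst (L : ℝ) (N : ℕ) : ℝ :=
  (L ^ 2)⁻¹ * ∑ k ∈ modes N, 1 / |eigenvalue L k|

/-- The energy functional with renormalisation constant `C`, on the torus of size `L`,
`½ ∫ (‖∇φ‖² - φ²) + ¼ ∫ (φ⁴ - 6 ε C φ² + 3 ε² C²)`. -/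
def energy (L ε C : ℝ) (φ : ℝ → ℝ → ℝ) : ℝ :=
  1 / 2 * (∫ x₁ in (0 : ℝ)..L, ∫ x₂ in (0 : ℝ)..L,
      ((deriv (fun s => φ s x₂) x₁) ^ 2 + (deriv (fun s => φ x₁ s) x₂) ^ 2 - φ x₁ x₂ ^ 2)) +
    1 / 4 * (∫ x₁ in (0 : ℝ)..L, ∫ x₂ in (0 : ℝ)..L,
      (φ x₁ x₂ ^ 4 - 6 * ε * C * φ x₁ x₂ ^ 2 + 3 * ε ^ 2 * C ^ 2))

/-- The potential `V_N` of the Galerkin approximation, as a function of the coordinates. -/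
def potential (L ε : ℝ) (N : ℕ) (z : Space N) : ℝ :=
  energy L ε (renormConst L N) (field L z)

/-! ### The capacity -/

/-- `G` is the gradient of `h` on the whole space in the sense of distributions. -/
def HasWeakGradient {N : ℕ} (h : Space N → ℝ) (G : Space N → Space N) : Prop :=
  MeasureTheory.LocallyIntegrable h MeasureTheory.volume ∧
  MeasureTheory.LocallyIntegrable G MeasureTheory.volume ∧
  ∀ ψ : Space N → ℝ, ContDiff ℝ (⊤ : ℕ∞) ψ → HasCompactSupport ψ → ∀ v : Space N,
    ∫ z, h z * fderiv ℝ ψ z v = -∫ z, inner ℝ (G z) v * ψ z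

/-- The (unnormalised) invariant measure `exp(-V_N(z)/ε) dz`. -/
def gibbsMeasure (L ε : ℝ) (N : ℕ) : MeasureTheory.Measure (Space N) :=
  MeasureTheory.volume.withDensity fun z => ENNReal.ofReal (Real.exp (-potential L ε N z / ε))

/-- `h` belongs to the Sobolev space `H¹` of the measure `exp(-V_N/ε) dz`, with weak gradient `G`,
and `h = 1` in `A`, `h = 0` in `B`. -/
structure Admissible (L ε : ℝ) (N : ℕ) (A B : Set (Space N))
    (h : Space N → ℝ) (G : Space N → Space N) : Prop where
  hasWeakGradient : HasWeakGradient h G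
  memLp : MeasureTheory.MemLp h 2 (gibbsMeasure L ε N)
  memLp_grad : MeasureTheory.MemLp G 2 (gibbsMeasure L ε N)
  eq_one : ∀ᵐ z ∂MeasureTheory.volume, z ∈ A → h z = 1
  eq_zero : ∀ᵐ z ∂MeasureTheory.volume, z ∈ B → h z = 0

/-- The capacity `cap_A(B) = ε inf_h ∫_{(A ∪ B)ᶜ} ‖∇h‖² exp(-V_N/ε) dz`, the infimum being over the
`h ∈ H¹` with `h = 1` in `A` and `h = 0` in `B`. -/
def capacity (L ε : ℝ) (N : ℕ) (A B : Set (Space N)) : ℝ≥0∞ :=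
  ENNReal.ofReal ε * ⨅ (h : Space N → ℝ) (G : Space N → Space N) (_ : Admissible L ε N A B h G),
    ∫⁻ z in (A ∪ B)ᶜ, ENNReal.ofReal (‖G z‖ ^ 2 * Real.exp (-potential L ε N z / ε))

/-- The set of fields whose mean `z₀ / L` lies in `[m - δ, m + δ]` and whose transversal part lies
in `S`. -/
def cylinder (L δ m : ℝ) {N : ℕ} (S : Set (PerpSpace N)) : Set (Space N) :=
  {z | zeroCoord z / L ∈ Set.Icc (m - δ) (m + δ) ∧ perpPart z ∈ S}

/-! ### The transversal Gaussian measure -/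

/-- The Gaussian probability measure `γ₀^⊥`, with density proportional to
`exp(-½ ∑_{0<|k|≤N} λ_k y_k²)`. -/
def perpGaussian (L : ℝ) (N : ℕ) : MeasureTheory.Measure (PerpSpace N) :=
  MeasureTheory.volume.withDensity fun y => ENNReal.ofReal
    ((∏ k : nonzeroModes N, √(2 * Real.pi / eigenvalue L k.1))⁻¹ *
      Real.exp (-(1 / 2 * ∑ k : nonzeroModes N, eigenvalue L k.1 * y k ^ 2)))

end

end AllenCahn

/-!
For an admissible function `h` the energy is bounded below by keeping only the derivative along
the mean mode `z₀` and only the lines `z_⊥ = const` through `Dperp`, between the two wells. On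
almost every such line `h` passes from one to zero, so the Cauchy-Schwarz inequality bounds the
energy of the line by the inverse of `∫ exp (V_N / ε) dz₀` (`lintegral_inv_le_energy`). The weak
gradient enters only through test functions `η (z₀) χ (z_⊥)`, with `η` approaching the indicator
of the interval between the wells (`ae_slice_integral_eq`, `integral_weakDeriv_eq_neg_one`).

After rescaling by `√ε`, the exponent `V_N / ε` is `-t²/2 + ½ ∑ λ_k y_k²` plus `ε` times an
interaction which, thanks to the counterterm `C_N`, involves the transversal field only through
the torus integrals of its Wick powers of order two, three and four (`potential_div_eq`). Between
the wells the quartic term in `t` costs at most half of the Gaussian exponent `t²/2`. Hence,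
as long as `ε` times these integrals is small, the partition function in `t` is `√(2π)` up to a
relative error of order `ε`, whereas on the rest of the transversal space the claimed lower bound
is negative. This gives a pointwise bound with the error `ε K wickError` on the whole space
(`exists_le_inv_partition`), whose average against the transversal Gaussian measure is the claim,
with an error of order `ε` for `ε ≤ 1`; for `ε ≥ 1` the claim is trivial.

Uniformity in the truncation `N` rests on the fact that the integrated Wick powers have bounded
second moments. If `X`, `Y` are jointly Gaussian with the same variance and covariance `ρ`, the
Wick powers of order `n` have covariance `n! ρⁿ` (`integral_wick_mul_wick`), so it suffices to
bound the `L⁴` norm of the truncated Green function. Its fourth power is a sum over resonant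
quadruples of wave vectors, which is at most `(∑ λ_k ^ (-4/3))³` (`sum_resonant_le`), and this
series converges in dimension two.
-/

open MeasureTheory ProbabilityTheory Set Filter Topology

namespace AllenCahn

/-! ### Trigonometric integrals on the torus -/

/-- Lebesgue measure on the fundamental domain `(0, L]²` of the torus. -/
noncomputable def torusMeasure (L : ℝ) : Measure (ℝ × ℝ) :=
  (volume.restrict (Ioc 0 L)).prod (volume.restrict (Ioc 0 L))

/-- The phase `(2π/L) k·p`. -/
noncomputable def phase (L : ℝ) (k : ℤ × ℤ) (p : ℝ × ℝ) : ℝ :=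
  2 * Real.pi / L * ((k.1 : ℝ) * p.1 + (k.2 : ℝ) * p.2)

/-- The real Fourier function `cos + sin` with wave vector `k`, without normalisation. -/
noncomputable def cas (L : ℝ) (k : ℤ × ℤ) (p : ℝ × ℝ) : ℝ :=
  Real.cos (phase L k p) + Real.sin (phase L k p)

@[fun_prop]
theorem continuous_phase (L : ℝ) (k : ℤ × ℤ) : Continuous (phase L k) := by
  unfold phase; fun_prop

@[fun_prop]
theorem continuous_cas (L : ℝ) (k : ℤ × ℤ) : Continuous (cas L k) := by
  unfold cas; fun_prop

theorem phase_add (L : ℝ) (k l : ℤ × ℤ) (p : ℝ × ℝ) :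
    phase L (k + l) p = phase L k p + phase L l p := by
  simp [phase]; ring

theorem phase_neg (L : ℝ) (k : ℤ × ℤ) (p : ℝ × ℝ) : phase L (-k) p = -phase L k p := by
  simp [phase]; ring

theorem cas_mul_cas (L : ℝ) (k l : ℤ × ℤ) (p q : ℝ × ℝ) :
    cas L k p * cas L l q =
      Real.cos (phase L k p - phase L l q) + Real.sin (phase L k p + phase L l q) := by
  simp only [cas, Real.cos_sub, Real.sin_add]; ring

instance (L : ℝ) : IsFiniteMeasure (torusMeasure L) := by
  unfold torusMeasure; infer_instance

theorem torusMeasure_real_univ {L : ℝ} (hL : 0 < L) : (torusMeasure L).real univ = L ^ 2 := by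
  rw [measureReal_def, torusMeasure, ← univ_prod_univ, Measure.prod_prod]
  simp [hL.le, sq]

theorem torusMeasure_le (L : ℝ) :
    torusMeasure L ≤ volume.restrict (Icc (0 : ℝ) L ×ˢ Icc (0 : ℝ) L) := by
  rw [torusMeasure, Measure.prod_restrict]
  exact Measure.restrict_mono (Set.prod_mono Ioc_subset_Icc_self Ioc_subset_Icc_self) le_rfl

theorem integrable_torusMeasure {L : ℝ} {f : ℝ × ℝ → ℝ} (hf : Continuous f) :
    Integrable f (torusMeasure L) :=
  Integrable.mono_measure
    (hf.locallyIntegrable.integrableOn_isCompact (isCompact_Icc.prod isCompact_Icc))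
    (torusMeasure_le L)

/-- Iterated integrals over the period square are integrals for `torusMeasure`. -/
theorem intervalIntegral_eq_integral_torusMeasure {L : ℝ} (hL : 0 < L) {f : ℝ → ℝ → ℝ}
    (hf : Continuous fun p : ℝ × ℝ => f p.1 p.2) :
    ∫ x₁ in (0 : ℝ)..L, ∫ x₂ in (0 : ℝ)..L, f x₁ x₂ = ∫ p, f p.1 p.2 ∂torusMeasure L := by
  rw [torusMeasure, integral_prod _ (integrable_torusMeasure hf),
    intervalIntegral.integral_of_le hL.le]
  simp only [intervalIntegral.integral_of_le hL.le]

theorem integral_cos_frequency {L : ℝ} (hL : 0 < L) (m : ℤ) :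
    ∫ x in Ioc 0 L, Real.cos (2 * Real.pi / L * (m * x)) = if m = 0 then L else 0 := by
  rw [← intervalIntegral.integral_of_le hL.le]
  split_ifs with h
  · simp [h]
  · have hm : (m : ℝ) ≠ 0 := by exact_mod_cast h
    have hc : 2 * Real.pi / L * m ≠ 0 := by have := Real.pi_pos; positivity
    simp only [← mul_assoc]
    rw [intervalIntegral.integral_comp_mul_left (fun x => Real.cos x) hc]
    have : 2 * Real.pi / L * m * L = m * (2 * Real.pi) := by field_simp
    simp only [this, integral_cos]
    have := Real.sin_add_int_mul_two_pi 0 m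
    simp_all

theorem integral_sin_frequency {L : ℝ} (hL : 0 < L) (m : ℤ) :
    ∫ x in Ioc 0 L, Real.sin (2 * Real.pi / L * (m * x)) = 0 := by
  rw [← intervalIntegral.integral_of_le hL.le]
  by_cases h : m = 0
  · simp [h]
  · have hm : (m : ℝ) ≠ 0 := by exact_mod_cast h
    have hc : 2 * Real.pi / L * m ≠ 0 := by have := Real.pi_pos; positivity
    simp only [← mul_assoc]
    rw [intervalIntegral.integral_comp_mul_left (fun x => Real.sin x) hc]
    have : 2 * Real.pi / L * m * L = m * (2 * Real.pi) := by field_simp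
    simp only [this, integral_sin]
    have := Real.cos_add_int_mul_two_pi 0 m
    simp_all

theorem integral_cos_phase {L : ℝ} (hL : 0 < L) (k : ℤ × ℤ) :
    ∫ p, Real.cos (phase L k p) ∂torusMeasure L = if k = 0 then L ^ 2 else 0 := by
  have h : ∀ p : ℝ × ℝ, Real.cos (phase L k p) =
      Real.cos (2 * Real.pi / L * (k.1 * p.1)) * Real.cos (2 * Real.pi / L * (k.2 * p.2)) -
      Real.sin (2 * Real.pi / L * (k.1 * p.1)) * Real.sin (2 * Real.pi / L * (k.2 * p.2)) := by
    intro p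
    rw [phase, mul_add, Real.cos_add]
  simp only [h]
  rw [integral_sub (integrable_torusMeasure (by fun_prop)) (integrable_torusMeasure (by fun_prop)),
    torusMeasure, integral_prod_mul (fun x : ℝ => Real.cos (2 * Real.pi / L * (k.1 * x)))
      (fun x : ℝ => Real.cos (2 * Real.pi / L * (k.2 * x))),
    integral_prod_mul (fun x : ℝ => Real.sin (2 * Real.pi / L * (k.1 * x)))
      (fun x : ℝ => Real.sin (2 * Real.pi / L * (k.2 * x)))]
  simp only [integral_cos_frequency hL, integral_sin_frequency hL, Prod.ext_iff]
  split_ifs <;> simp_all [sq]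

theorem integral_sin_phase {L : ℝ} (hL : 0 < L) (k : ℤ × ℤ) :
    ∫ p, Real.sin (phase L k p) ∂torusMeasure L = 0 := by
  have h : ∀ p : ℝ × ℝ, Real.sin (phase L k p) =
      Real.sin (2 * Real.pi / L * (k.1 * p.1)) * Real.cos (2 * Real.pi / L * (k.2 * p.2)) +
      Real.cos (2 * Real.pi / L * (k.1 * p.1)) * Real.sin (2 * Real.pi / L * (k.2 * p.2)) := by
    intro p
    rw [phase, mul_add, Real.sin_add]
  simp only [h]
  rw [integral_add (integrable_torusMeasure (by fun_prop)) (integrable_torusMeasure (by fun_prop)),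
    torusMeasure, integral_prod_mul (fun x : ℝ => Real.sin (2 * Real.pi / L * (k.1 * x)))
      (fun x : ℝ => Real.cos (2 * Real.pi / L * (k.2 * x))),
    integral_prod_mul (fun x : ℝ => Real.cos (2 * Real.pi / L * (k.1 * x)))
      (fun x : ℝ => Real.sin (2 * Real.pi / L * (k.2 * x)))]
  simp [integral_sin_frequency hL]

theorem integral_cas {L : ℝ} (hL : 0 < L) {k : ℤ × ℤ} (hk : k ≠ 0) :
    ∫ p, cas L k p ∂torusMeasure L = 0 := by
  simp only [cas]
  rw [integral_add (integrable_torusMeasure (by fun_prop)) (integrable_torusMeasure (by fun_prop)),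
    integral_cos_phase hL, integral_sin_phase hL]
  simp [hk]

theorem integral_cas_mul_cas {L : ℝ} (hL : 0 < L) (k l : ℤ × ℤ) :
    ∫ p, cas L k p * cas L l p ∂torusMeasure L = if k = l then L ^ 2 else 0 := by
  have h : ∀ p, cas L k p * cas L l p =
      Real.cos (phase L (k - l) p) + Real.sin (phase L (k + l) p) := by
    intro p
    rw [cas_mul_cas, sub_eq_add_neg k, phase_add, phase_add, phase_neg, sub_eq_add_neg]
  simp only [h]
  rw [integral_add (integrable_torusMeasure (by fun_prop)) (integrable_torusMeasure (by fun_prop)),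
    integral_cos_phase hL, integral_sin_phase hL]
  simp [sub_eq_zero]

/-- Parseval's identity for the orthogonal system `cas`. -/
theorem integral_sum_cas_sq {ι : Type*} [Fintype ι] {L : ℝ} (hL : 0 < L) {m : ι → ℤ × ℤ}
    (hm : Function.Injective m) (c : ι → ℝ) :
    ∫ p, (∑ i, c i * cas L (m i) p) ^ 2 ∂torusMeasure L = L ^ 2 * ∑ i, c i ^ 2 := by
  classical
  have h : ∀ p, (∑ i, c i * cas L (m i) p) ^ 2 =
      ∑ i, ∑ j, c i * c j * (cas L (m i) p * cas L (m j) p) := by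
    intro p
    rw [sq, Finset.sum_mul_sum]
    refine Finset.sum_congr rfl fun i _ => Finset.sum_congr rfl fun j _ => by ring
  simp only [h]
  rw [integral_finsetSum _ fun i _ => integrable_torusMeasure (by fun_prop), Finset.mul_sum]
  refine Finset.sum_congr rfl fun i _ => ?_
  rw [integral_finsetSum _ fun j _ => integrable_torusMeasure (by fun_prop)]
  simp only [integral_const_mul, integral_cas_mul_cas hL, hm.eq_iff]
  simp
  ring

/-! ### Expansion of the potential -/

/-- The field on the torus whose mean vanishes, with transversal coordinates `y`. -/
noncomputable def perpField (L : ℝ) {N : ℕ} (y : PerpSpace N) (p : ℝ × ℝ) : ℝ :=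
  ∑ k : nonzeroModes N, y k * (L⁻¹ * cas L k.1 p)

@[fun_prop]
theorem continuous_perpField (L : ℝ) {N : ℕ} (y : PerpSpace N) : Continuous (perpField L y) := by
  unfold perpField; fun_prop

theorem ne_zero_of_nonzeroModes {N : ℕ} (k : nonzeroModes N) : k.1 ≠ 0 :=
  Finset.ne_of_mem_erase k.2

theorem integral_perpField {L : ℝ} (hL : 0 < L) {N : ℕ} (y : PerpSpace N) :
    ∫ p, perpField L y p ∂torusMeasure L = 0 := by
  simp only [perpField]
  rw [integral_finsetSum _ fun i _ => integrable_torusMeasure (by fun_prop)]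
  simp [integral_const_mul, integral_cas hL (ne_zero_of_nonzeroModes _)]

theorem sum_coe_eq_add_sum_erase {ι M : Type*} [DecidableEq ι] [AddCommMonoid M] {S : Finset ι}
    {i₀ : ι} (h₀ : i₀ ∈ S) (f : S → M) :
    ∑ k, f k = f ⟨i₀, h₀⟩ + ∑ k : S.erase i₀, f ⟨k.1, Finset.mem_of_mem_erase k.2⟩ := by
  let F : ι → M := fun k => if h : k ∈ S then f ⟨k, h⟩ else 0
  have h1 : ∑ k, f k = ∑ k ∈ S, F k := by
    rw [← Finset.sum_coe_sort S F]
    exact Finset.sum_congr rfl fun k _ => by simp [F]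
  have h2 : ∑ k : S.erase i₀, f ⟨k.1, Finset.mem_of_mem_erase k.2⟩ = ∑ k ∈ S.erase i₀, F k := by
    rw [← Finset.sum_coe_sort (S.erase i₀) F]
    exact Finset.sum_congr rfl fun k _ => by simp [F, Finset.mem_of_mem_erase k.2]
  rw [h1, h2, ← Finset.add_sum_erase _ _ h₀]
  simp [F, h₀]

theorem sum_modes_eq {M : Type*} [AddCommMonoid M] {N : ℕ} (f : modes N → M) :
    ∑ k, f k = f ⟨0, zero_mem_modes N⟩ +
      ∑ k : nonzeroModes N, f ⟨k.1, Finset.mem_of_mem_erase k.2⟩ :=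
  sum_coe_eq_add_sum_erase (zero_mem_modes N) f

theorem field_eq (L : ℝ) {N : ℕ} (z : Space N) (p : ℝ × ℝ) :
    field L z p.1 p.2 = zeroCoord z / L + perpField L (perpPart z) p := by
  rw [field, sum_modes_eq]
  simp [zeroCoord, perpField, perpPart, cas, phase, div_eq_mul_inv]

theorem field_eq_sum_cas (L : ℝ) {N : ℕ} (z : Space N) (x₁ x₂ : ℝ) :
    field L z x₁ x₂ = ∑ k : modes N, (z k * L⁻¹) * cas L k.1 (x₁, x₂) := by
  simp [field, cas, phase, mul_assoc]

theorem deriv_field_fst (L : ℝ) {N : ℕ} (z : Space N) (x₁ x₂ : ℝ) :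
    deriv (fun s => field L z s x₂) x₁ =
      ∑ k : modes N, (z k * L⁻¹ * (2 * Real.pi / L * k.1.1)) * cas L (-k.1) (x₁, x₂) := by
  apply HasDerivAt.deriv
  simp only [field_eq_sum_cas]
  apply HasDerivAt.fun_sum
  intro k _
  have h1 : HasDerivAt (fun s => phase L k.1 (s, x₂)) (2 * Real.pi / L * k.1.1) x₁ := by
    simp only [phase]
    have := (((hasDerivAt_id x₁).const_mul (k.1.1 : ℝ)).add_const ((k.1.2 : ℝ) * x₂)).const_mul
      (2 * Real.pi / L)
    simpa using this
  have h2 := (h1.cos.add h1.sin).const_mul (z k * L⁻¹)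
  convert! h2 using 1
  simp only [cas, phase_neg, Real.cos_neg, Real.sin_neg]
  ring

theorem deriv_field_snd (L : ℝ) {N : ℕ} (z : Space N) (x₁ x₂ : ℝ) :
    deriv (fun s => field L z x₁ s) x₂ =
      ∑ k : modes N, (z k * L⁻¹ * (2 * Real.pi / L * k.1.2)) * cas L (-k.1) (x₁, x₂) := by
  apply HasDerivAt.deriv
  simp only [field_eq_sum_cas]
  apply HasDerivAt.fun_sum
  intro k _
  have h1 : HasDerivAt (fun s => phase L k.1 (x₁, s)) (2 * Real.pi / L * k.1.2) x₂ := by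
    simp only [phase]
    have := (((hasDerivAt_id x₂).const_mul (k.1.2 : ℝ)).const_add ((k.1.1 : ℝ) * x₁)).const_mul
      (2 * Real.pi / L)
    simpa using this
  have h2 := (h1.cos.add h1.sin).const_mul (z k * L⁻¹)
  convert! h2 using 1
  simp only [cas, phase_neg, Real.cos_neg, Real.sin_neg]
  ring

theorem integral_gradient_sub_sq {L : ℝ} (hL : 0 < L) {N : ℕ} (z : Space N) :
    ∫ x₁ in (0 : ℝ)..L, ∫ x₂ in (0 : ℝ)..L,
      ((deriv (fun s => field L z s x₂) x₁) ^ 2 + (deriv (fun s => field L z x₁ s) x₂) ^ 2 -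
        field L z x₁ x₂ ^ 2) = ∑ k : modes N, eigenvalue L k.1 * z k ^ 2 := by
  simp only [deriv_field_fst, deriv_field_snd]
  simp only [field_eq_sum_cas]
  have hi : Function.Injective fun k : modes N => k.1 := Subtype.val_injective
  have hi' : Function.Injective fun k : modes N => -k.1 := neg_injective.comp hi
  rw [intervalIntegral_eq_integral_torusMeasure hL (by simp only [cas, phase]; fun_prop)]
  simp only [Prod.mk.eta]
  rw [integral_sub (integrable_torusMeasure (by fun_prop)) (integrable_torusMeasure (by fun_prop)),
    integral_add (integrable_torusMeasure (by fun_prop)) (integrable_torusMeasure (by fun_prop)),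
    integral_sum_cas_sq hL hi', integral_sum_cas_sq hL hi', integral_sum_cas_sq hL hi,
    ← mul_add, ← mul_sub, ← Finset.sum_add_distrib, ← Finset.sum_sub_distrib, Finset.mul_sum]
  refine Finset.sum_congr rfl fun k _ => ?_
  simp only [eigenvalue]
  field_simp

/-- The potential is a diagonal quadratic form plus the renormalised quartic interaction. -/
theorem potential_eq {L : ℝ} (hL : 0 < L) (ε : ℝ) {N : ℕ} (z : Space N) :
    potential L ε N z = 1 / 2 * (-zeroCoord z ^ 2 +
        ∑ k : nonzeroModes N, eigenvalue L k.1 * perpPart z k ^ 2) +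
      1 / 4 * ∫ p, ((zeroCoord z / L + perpField L (perpPart z) p) ^ 4 -
        6 * ε * renormConst L N * (zeroCoord z / L + perpField L (perpPart z) p) ^ 2 +
        3 * ε ^ 2 * renormConst L N ^ 2) ∂torusMeasure L := by
  rw [potential, energy, integral_gradient_sub_sq hL, sum_modes_eq,
    intervalIntegral_eq_integral_torusMeasure hL]
  · simp only [field_eq]
    simp [eigenvalue, zeroCoord, perpPart]
  · simp only [field_eq]
    fun_prop

/-! ### Gaussian moments and Wick polynomials -/

theorem integrable_pow_gaussianReal (v : NNReal) (n : ℕ) :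
    Integrable (fun x : ℝ => x ^ n) (gaussianReal 0 v) := by
  have h := memLp_id_gaussianReal (μ := 0) (v := v) n
  rcases Nat.eq_zero_or_pos n with rfl | hn
  · simp
  · have := h.integrable_norm_pow hn.ne'
    refine this.mono' (by fun_prop) (Eventually.of_forall fun x => ?_)
    simp

/-- The recursion between the moments of a centred Gaussian, from integration by parts. -/
theorem integral_pow_add_two_gaussianReal (v : NNReal) (n : ℕ) :
    ∫ x, x ^ (n + 2) ∂gaussianReal 0 v = (n + 1) * v * ∫ x, x ^ n ∂gaussianReal 0 v := by
  by_cases hv : v = 0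
  · subst hv; simp
  have hv' : (v : ℝ) ≠ 0 := by exact_mod_cast hv
  have hint : ∀ m : ℕ, Integrable (fun x : ℝ => gaussianPDFReal 0 v x * x ^ m) := by
    intro m
    have h := integrable_pow_gaussianReal v m
    rw [gaussianReal_of_var_ne_zero _ hv, gaussianPDF_def,
      integrable_withDensity_iff_integrable_smul₀' (by fun_prop) (by simp)] at h
    refine h.congr (Eventually.of_forall fun x => ?_)
    simp [ENNReal.toReal_ofReal (gaussianPDFReal_nonneg 0 v x)]
  have hderiv : ∀ x : ℝ, HasDerivAt (fun x => gaussianPDFReal 0 v x * x ^ (n + 1))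
      (gaussianPDFReal 0 v x * ((n + 1) * x ^ n - x ^ (n + 2) / v)) x := by
    intro x
    have h1 : HasDerivAt (gaussianPDFReal 0 v) (gaussianPDFReal 0 v x * (-x / v)) x := by
      rw [gaussianPDFReal_def]
      have := (((((hasDerivAt_id x).sub_const 0).pow 2).neg).div_const (2 * (v : ℝ))).exp.const_mul
        (√(2 * Real.pi * v))⁻¹
      convert! this using 1
      simp
      field_simp
    have := h1.mul (hasDerivAt_pow (n + 1) x)
    convert! this using 1
    push_cast
    field_simp
    ring
  have h0 := integral_eq_zero_of_hasDerivAt_of_integrable hderiv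
    (by
      have := ((hint n).const_mul ((n : ℝ) + 1)).sub ((hint (n + 2)).div_const (v : ℝ))
      refine this.congr (Eventually.of_forall fun x => ?_)
      simp; ring) (hint (n + 1))
  have h2 : ∫ x, gaussianPDFReal 0 v x * ((n + 1) * x ^ n - x ^ (n + 2) / v) =
      (n + 1) * (∫ x, gaussianPDFReal 0 v x * x ^ n) -
        (∫ x, gaussianPDFReal 0 v x * x ^ (n + 2)) / v := by
    rw [← integral_const_mul, ← integral_div, ← integral_sub ((hint n).const_mul _)
      ((hint (n + 2)).div_const _)]
    congr 1
    ext x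
    ring
  rw [integral_gaussianReal_eq_integral_smul hv, integral_gaussianReal_eq_integral_smul hv]
  simp only [smul_eq_mul]
  rw [h2] at h0
  field_simp at h0
  linarith

theorem integral_pow_gaussianReal (v : NNReal) :
    (∫ x, x ^ 1 ∂gaussianReal 0 v = 0) ∧ (∫ x, x ^ 2 ∂gaussianReal 0 v = v) ∧
    (∫ x, x ^ 3 ∂gaussianReal 0 v = 0) ∧ (∫ x, x ^ 4 ∂gaussianReal 0 v = 3 * v ^ 2) ∧
    (∫ x, x ^ 5 ∂gaussianReal 0 v = 0) ∧ (∫ x, x ^ 6 ∂gaussianReal 0 v = 15 * v ^ 3) ∧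
    (∫ x, x ^ 7 ∂gaussianReal 0 v = 0) ∧ (∫ x, x ^ 8 ∂gaussianReal 0 v = 105 * v ^ 4) := by
  have h0 : ∫ x : ℝ, x ^ 0 ∂gaussianReal 0 v = 1 := by simp
  have h1 : ∫ x : ℝ, x ^ 1 ∂gaussianReal 0 v = 0 := by simp
  have h2 := integral_pow_add_two_gaussianReal v 0
  have h3 := integral_pow_add_two_gaussianReal v 1
  have h4 := integral_pow_add_two_gaussianReal v 2
  have h5 := integral_pow_add_two_gaussianReal v 3
  have h6 := integral_pow_add_two_gaussianReal v 4
  have h7 := integral_pow_add_two_gaussianReal v 5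
  have h8 := integral_pow_add_two_gaussianReal v 6
  norm_num only [Nat.reduceAdd] at h2 h3 h4 h5 h6 h7 h8
  rw [h0] at h2
  rw [h1] at h3
  rw [h2] at h4
  rw [h3] at h5
  rw [h4] at h6
  rw [h5] at h7
  rw [h6] at h8
  refine ⟨h1, ?_, ?_, ?_, ?_, ?_, ?_, ?_⟩
  · rw [h2]; ring
  · rw [h3]; ring
  · rw [h4]; ring
  · rw [h5]; ring
  · rw [h6]; ring
  · rw [h7]; ring
  · rw [h8]; ring

theorem integral_poly_gaussianReal (v : NNReal) (a₀ a₁ a₂ a₃ a₄ a₅ a₆ a₇ a₈ : ℝ) :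
    ∫ x, (a₀ + a₁ * x ^ 1 + a₂ * x ^ 2 + a₃ * x ^ 3 + a₄ * x ^ 4 + a₅ * x ^ 5 + a₆ * x ^ 6 +
      a₇ * x ^ 7 + a₈ * x ^ 8) ∂gaussianReal 0 v =
    a₀ + a₂ * v + 3 * a₄ * v ^ 2 + 15 * a₆ * v ^ 3 + 105 * a₈ * v ^ 4 := by
  have hi : ∀ (a : ℝ) (n : ℕ), Integrable (fun x : ℝ => a * x ^ n) (gaussianReal 0 v) :=
    fun a n => (integrable_pow_gaussianReal v n).const_mul a
  obtain ⟨h1, h2, h3, h4, h5, h6, h7, h8⟩ := integral_pow_gaussianReal v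
  have i0 := integrable_const (μ := gaussianReal 0 v) a₀
  have i1 := i0.fun_add (hi a₁ 1)
  have i2 := i1.fun_add (hi a₂ 2)
  have i3 := i2.fun_add (hi a₃ 3)
  have i4 := i3.fun_add (hi a₄ 4)
  have i5 := i4.fun_add (hi a₅ 5)
  have i6 := i5.fun_add (hi a₆ 6)
  have i7 := i6.fun_add (hi a₇ 7)
  rw [integral_add i7 (hi a₈ 8), integral_add i6 (hi a₇ 7), integral_add i5 (hi a₆ 6),
    integral_add i4 (hi a₅ 5), integral_add i3 (hi a₄ 4), integral_add i2 (hi a₃ 3),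
    integral_add i1 (hi a₂ 2), integral_add i0 (hi a₁ 1)]
  simp only [integral_const_mul, h1, h2, h3, h4, h5, h6, h7, h8]
  simp
  ring

/-- The second Wick power of a centred Gaussian of variance `c`. -/
def wickTwo (c t : ℝ) : ℝ := t ^ 2 - c

/-- The third Wick power of a centred Gaussian of variance `c`. -/
def wickThree (c t : ℝ) : ℝ := t ^ 3 - 3 * c * t

/-- The fourth Wick power of a centred Gaussian of variance `c`. -/
def wickFour (c t : ℝ) : ℝ := t ^ 4 - 6 * c * t ^ 2 + 3 * c ^ 2

theorem integrable_polynomial_gaussianReal (v : NNReal) (P : Polynomial ℝ) :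
    Integrable (fun x => P.eval x) (gaussianReal 0 v) := by
  simp only [Polynomial.eval_eq_sum_range]
  exact integrable_finsetSum _ fun j _ => (integrable_pow_gaussianReal v j).const_mul _

theorem integrable_prod_gaussianReal_poly (c d : NNReal) {f : ℝ × ℝ → ℝ}
    (P : Fin 5 → Polynomial ℝ)
    (hf : ∀ x z, f (x, z) = ∑ j : Fin 5, (P j).eval x * z ^ (j : ℕ)) :
    Integrable f ((gaussianReal 0 c).prod (gaussianReal 0 d)) := by
  have : f = fun p : ℝ × ℝ => ∑ j : Fin 5, (P j).eval p.1 * p.2 ^ (j : ℕ) :=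
    funext fun p => hf p.1 p.2
  rw [this]
  exact integrable_finsetSum _ fun j _ =>
    (integrable_polynomial_gaussianReal c (P j)).mul_prod (integrable_pow_gaussianReal d j)

open Polynomial in
theorem integral_wickTwo_mul_prod (c d : NNReal) (r : ℝ) (h : r ^ 2 * c + d = c) :
    ∫ p : ℝ × ℝ, wickTwo c p.1 * wickTwo c (r * p.1 + p.2)
      ∂(gaussianReal 0 c).prod (gaussianReal 0 d) = 2 * (r * c) ^ 2 := by
  have hd : (d : ℝ) = c - r ^ 2 * c := by linarith
  rw [integral_prod]
  · have inner : ∀ x : ℝ, ∫ z, wickTwo c x * wickTwo c (r * x + z) ∂gaussianReal 0 d =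
        r ^ 2 * wickTwo c x ^ 2 := by
      intro x
      have := integral_poly_gaussianReal d (wickTwo c x * (r ^ 2 * x ^ 2 - c))
        (wickTwo c x * (2 * r * x)) (wickTwo c x) 0 0 0 0 0 0
      refine ((integral_congr_ae (Eventually.of_forall fun z => ?_)).trans this).trans ?_
      · simp only [wickTwo]; ring
      · rw [hd]; simp only [wickTwo]; ring
    simp only [inner]
    have := integral_poly_gaussianReal c (r ^ 2 * c ^ 2) 0 (-2 * r ^ 2 * c) 0 (r ^ 2) 0 0 0 0
    refine ((integral_congr_ae (Eventually.of_forall fun z => ?_)).trans this).trans ?_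
    · simp only [wickTwo]; ring
    · ring
  · refine integrable_prod_gaussianReal_poly c d
      ![(X ^ 2 - C (c : ℝ)) * (C (r ^ 2) * X ^ 2 - C (c : ℝ)), (X ^ 2 - C (c : ℝ)) * (C (2 * r) * X),
        X ^ 2 - C (c : ℝ), 0, 0] fun x z => ?_
    simp [Fin.sum_univ_succ, wickTwo]
    ring

open Polynomial in
theorem integral_wickThree_mul_prod (c d : NNReal) (r : ℝ) (h : r ^ 2 * c + d = c) :
    ∫ p : ℝ × ℝ, wickThree c p.1 * wickThree c (r * p.1 + p.2)
      ∂(gaussianReal 0 c).prod (gaussianReal 0 d) = 6 * (r * c) ^ 3 := by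
  have hd : (d : ℝ) = c - r ^ 2 * c := by linarith
  rw [integral_prod]
  · have inner : ∀ x : ℝ, ∫ z, wickThree c x * wickThree c (r * x + z) ∂gaussianReal 0 d =
        r ^ 3 * wickThree c x ^ 2 := by
      intro x
      have := integral_poly_gaussianReal d (wickThree c x * (r ^ 3 * x ^ 3 - 3 * c * r * x))
        (wickThree c x * (3 * r ^ 2 * x ^ 2 - 3 * c)) (wickThree c x * (3 * r * x))
        (wickThree c x) 0 0 0 0 0
      refine ((integral_congr_ae (Eventually.of_forall fun z => ?_)).trans this).trans ?_
      · simp only [wickThree]; ring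
      · rw [hd]; simp only [wickThree]; ring
    simp only [inner]
    have := integral_poly_gaussianReal c 0 0 (9 * r ^ 3 * c ^ 2) 0 (-6 * r ^ 3 * c) 0 (r ^ 3) 0 0
    refine ((integral_congr_ae (Eventually.of_forall fun z => ?_)).trans this).trans ?_
    · simp only [wickThree]; ring
    · ring
  · refine integrable_prod_gaussianReal_poly c d
      ![(X ^ 3 - C (3 * c : ℝ) * X) * (C (r ^ 3) * X ^ 3 - C (3 * c * r) * X),
        (X ^ 3 - C (3 * c : ℝ) * X) * (C (3 * r ^ 2) * X ^ 2 - C (3 * c : ℝ)),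
        (X ^ 3 - C (3 * c : ℝ) * X) * (C (3 * r) * X), X ^ 3 - C (3 * c : ℝ) * X, 0] fun x z => ?_
    simp [Fin.sum_univ_succ, wickThree]
    ring

open Polynomial in
theorem integral_wickFour_mul_prod (c d : NNReal) (r : ℝ) (h : r ^ 2 * c + d = c) :
    ∫ p : ℝ × ℝ, wickFour c p.1 * wickFour c (r * p.1 + p.2)
      ∂(gaussianReal 0 c).prod (gaussianReal 0 d) = 24 * (r * c) ^ 4 := by
  have hd : (d : ℝ) = c - r ^ 2 * c := by linarith
  rw [integral_prod]
  · have inner : ∀ x : ℝ, ∫ z, wickFour c x * wickFour c (r * x + z) ∂gaussianReal 0 d =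
        r ^ 4 * wickFour c x ^ 2 := by
      intro x
      have := integral_poly_gaussianReal d
        (wickFour c x * (r ^ 4 * x ^ 4 - 6 * c * r ^ 2 * x ^ 2 + 3 * c ^ 2))
        (wickFour c x * (4 * r ^ 3 * x ^ 3 - 12 * c * r * x))
        (wickFour c x * (6 * r ^ 2 * x ^ 2 - 6 * c)) (wickFour c x * (4 * r * x))
        (wickFour c x) 0 0 0 0
      refine ((integral_congr_ae (Eventually.of_forall fun z => ?_)).trans this).trans ?_
      · simp only [wickFour]; ring
      · rw [hd]; simp only [wickFour]; ring
    simp only [inner]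
    have := integral_poly_gaussianReal c (r ^ 4 * (9 * c ^ 4)) 0 (r ^ 4 * (-36 * c ^ 3)) 0
      (r ^ 4 * (42 * c ^ 2)) 0 (r ^ 4 * (-12 * c)) 0 (r ^ 4)
    refine ((integral_congr_ae (Eventually.of_forall fun z => ?_)).trans this).trans ?_
    · simp only [wickFour]; ring
    · ring
  · refine integrable_prod_gaussianReal_poly c d
      ![(X ^ 4 - C (6 * c : ℝ) * X ^ 2 + C (3 * c ^ 2 : ℝ)) *
          (C (r ^ 4) * X ^ 4 - C (6 * c * r ^ 2) * X ^ 2 + C (3 * c ^ 2 : ℝ)),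
        (X ^ 4 - C (6 * c : ℝ) * X ^ 2 + C (3 * c ^ 2 : ℝ)) *
          (C (4 * r ^ 3) * X ^ 3 - C (12 * c * r) * X),
        (X ^ 4 - C (6 * c : ℝ) * X ^ 2 + C (3 * c ^ 2 : ℝ)) * (C (6 * r ^ 2) * X ^ 2 - C (6 * c : ℝ)),
        (X ^ 4 - C (6 * c : ℝ) * X ^ 2 + C (3 * c ^ 2 : ℝ)) * (C (4 * r) * X),
        X ^ 4 - C (6 * c : ℝ) * X ^ 2 + C (3 * c ^ 2 : ℝ)] fun x z => ?_
    simp [Fin.sum_univ_succ, wickFour]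
    ring

/-- Two jointly Gaussian centred variables with the same variance `c` can be decorrelated: for a
test function of both, the pair may be replaced by `(x, r x + z)` with independent `x`, `z`. -/
theorem exists_integral_eq_prod_gaussianReal {Ω : Type*} [MeasurableSpace Ω] {P : Measure Ω}
    {X Y : Ω → ℝ} (hXY : HasGaussianLaw (fun ω => (X ω, Y ω)) P) (hX : P[X] = 0) (hY : P[Y] = 0)
    {c : NNReal} (hcX : Var[X; P] = c) (hcY : Var[Y; P] = c) :
    ∃ (r : ℝ) (d : NNReal), r ^ 2 * c + d = c ∧ r * c = cov[X, Y; P] ∧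
      ∀ F : ℝ × ℝ → ℝ, Measurable F → ∫ ω, F (X ω, Y ω) ∂P =
        ∫ p : ℝ × ℝ, F (p.1, r * p.1 + p.2) ∂(gaussianReal 0 c).prod (gaussianReal 0 d) := by
  have hP := hXY.isProbabilityMeasure
  set ρ := cov[X, Y; P] with hρ
  have hXm := hXY.fst.memLp_two
  have hYm := hXY.snd.memLp_two
  have hρc : ρ / c * c = ρ := by
    by_cases hc : (c : ℝ) = 0
    · have hX0 : X =ᵐ[P] fun _ => 0 := by
        filter_upwards [ae_eq_integral_of_variance_eq_zero hXm (hcX.trans hc)] with ω hω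
        simpa [hX] using hω
      have : ρ = 0 := by
        rw [hρ, covariance_eq_sub hXm hYm, hX, integral_congr_ae (g := fun _ => (0 : ℝ))]
        · simp
        · filter_upwards [hX0] with ω h using by simp [h]
      simp [this]
    · field_simp
  set r := ρ / c with hr
  let Z : Ω → ℝ := fun ω => Y ω - r * X ω
  have hXZ : HasGaussianLaw (fun ω => (X ω, Z ω)) P := by
    have := hXY.map_fun ((ContinuousLinearMap.fst ℝ ℝ ℝ).prod
      (ContinuousLinearMap.snd ℝ ℝ ℝ - r • ContinuousLinearMap.fst ℝ ℝ ℝ))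
    simpa [Z] using this
  have hrX : MemLp (fun ω => r * X ω) 2 P := hXm.const_mul r
  have hcov : cov[X, Z; P] = 0 := by
    simp only [Z]
    rw [covariance_fun_sub_right hXm hYm hrX, covariance_const_mul_right,
      covariance_self hXY.fst.aemeasurable, hcX, hρc, hρ, sub_self]
  have hZ0 : P[Z] = 0 := by
    simp only [Z]
    rw [integral_sub (hYm.integrable (by norm_num)) (hrX.integrable (by norm_num)),
      integral_const_mul, hX, hY]
    simp
  have hind := hXZ.indepFun_of_covariance_eq_zero hcov
  have hvar : r ^ 2 * c + Var[Z; P] = c := by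
    have h1 : Y = Z + fun ω => r * X ω := by ext ω; simp [Z]
    have h2 : cov[Z, fun ω => r * X ω; P] = 0 := by
      rw [covariance_const_mul_right, covariance_comm, hcov, mul_zero]
    have h3 := variance_add hXZ.snd.memLp_two hrX
    rw [← h1, hcY, h2, variance_const_mul, hcX] at h3
    linarith
  refine ⟨r, Var[Z; P].toNNReal, ?_, hρc, fun F hF => ?_⟩
  · rw [Real.coe_toNNReal _ (variance_nonneg _ _)]; exact hvar
  · have hmap := (indepFun_iff_map_prod_eq_prod_map_map hXZ.fst.aemeasurable
      hXZ.snd.aemeasurable).1 hind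
    rw [hXZ.fst.map_eq_gaussianReal, hXZ.snd.map_eq_gaussianReal, hX, hZ0, hcX,
      Real.toNNReal_coe] at hmap
    rw [← hmap, integral_map hXZ.aemeasurable]
    · simp [Z]
    · exact (hF.comp (by fun_prop)).aestronglyMeasurable

theorem integral_wick_mul_wick {Ω : Type*} [MeasurableSpace Ω] {P : Measure Ω}
    {X Y : Ω → ℝ} (hXY : HasGaussianLaw (fun ω => (X ω, Y ω)) P) (hX : P[X] = 0) (hY : P[Y] = 0)
    {c : ℝ} (hcX : Var[X; P] = c) (hcY : Var[Y; P] = c) :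
    (∫ ω, wickTwo c (X ω) * wickTwo c (Y ω) ∂P = 2 * cov[X, Y; P] ^ 2) ∧
    (∫ ω, wickThree c (X ω) * wickThree c (Y ω) ∂P = 6 * cov[X, Y; P] ^ 3) ∧
    (∫ ω, wickFour c (X ω) * wickFour c (Y ω) ∂P = 24 * cov[X, Y; P] ^ 4) := by
  lift c to NNReal using hcX ▸ variance_nonneg _ _
  obtain ⟨r, d, h, hρ, hF⟩ := exists_integral_eq_prod_gaussianReal hXY hX hY hcX hcY
  rw [← hρ]
  refine ⟨?_, ?_, ?_⟩
  · rw [hF (fun p => wickTwo c p.1 * wickTwo c p.2) (by unfold wickTwo; fun_prop)]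
    exact integral_wickTwo_mul_prod c d r h
  · rw [hF (fun p => wickThree c p.1 * wickThree c p.2) (by unfold wickThree; fun_prop)]
    exact integral_wickThree_mul_prod c d r h
  · rw [hF (fun p => wickFour c p.1 * wickFour c p.2) (by unfold wickFour; fun_prop)]
    exact integral_wickFour_mul_prod c d r h

/-! ### The transversal Gaussian measure -/

theorem one_le_sq_add_sq_of_ne_zero {k : ℤ × ℤ} (hk : k ≠ 0) :
    (1 : ℝ) ≤ (k.1 : ℝ) ^ 2 + (k.2 : ℝ) ^ 2 := by
  have : 0 < k.1 ^ 2 + k.2 ^ 2 := by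
    rcases not_and_or.1 (mt Prod.ext_iff.2 hk) with h | h
    · have : 0 < k.1 ^ 2 := sq_pos_of_ne_zero h
      positivity
    · have : 0 < k.2 ^ 2 := sq_pos_of_ne_zero h
      positivity
  exact_mod_cast this

theorem eigenvalue_pos {L : ℝ} (hL : 0 < L) (hL' : L < 2 * Real.pi) {k : ℤ × ℤ} (hk : k ≠ 0) :
    0 < eigenvalue L k := by
  have h1 : 1 < (2 * Real.pi / L) ^ 2 := one_lt_pow₀ ((one_lt_div hL).2 hL') two_ne_zero
  have h2 := one_le_sq_add_sq_of_ne_zero hk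
  unfold eigenvalue
  nlinarith

/-- A product of measures with densities has the product density. -/
theorem pi_withDensity_ofReal {ι : Type*} [Fintype ι] {f : ι → ℝ → ℝ}
    (hf : ∀ i, Integrable (f i)) (h0 : ∀ i x, 0 ≤ f i x) :
    Measure.pi (fun i => volume.withDensity fun x => ENNReal.ofReal (f i x)) =
      (volume : Measure (ι → ℝ)).withDensity fun x => ENNReal.ofReal (∏ i, f i (x i)) := by
  have : ∀ i, IsFiniteMeasure (volume.withDensity fun x => ENNReal.ofReal (f i x)) :=
    fun i => isFiniteMeasure_withDensity_ofReal (hf i).2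
  refine (Measure.pi_eq fun s hs => ?_)
  rw [withDensity_apply _ (MeasurableSet.univ_pi hs), volume_pi, Measure.restrict_pi_pi,
    ← ofReal_integral_eq_lintegral_ofReal
      (Integrable.fintype_prod fun i => (hf i).restrict)
      (Eventually.of_forall fun x => Finset.prod_nonneg fun i _ => h0 i _),
    integral_fintype_prod_eq_prod, ENNReal.ofReal_prod_of_nonneg
      fun i _ => integral_nonneg (h0 i)]
  refine Finset.prod_congr rfl fun i _ => ?_
  rw [withDensity_apply _ (hs i), ← ofReal_integral_eq_lintegral_ofReal (hf i).restrict
    (Eventually.of_forall (h0 i))]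

/-- The variance `1 / λ_k` of the coordinate `y_k`. -/
noncomputable def modeVariance (L : ℝ) (k : ℤ × ℤ) : NNReal := Real.toNNReal (1 / eigenvalue L k)

theorem coe_modeVariance {L : ℝ} (hL : 0 < L) (hL' : L < 2 * Real.pi) {k : ℤ × ℤ} (hk : k ≠ 0) :
    (modeVariance L k : ℝ) = 1 / eigenvalue L k :=
  Real.coe_toNNReal _ (one_div_pos.2 (eigenvalue_pos hL hL' hk)).le

/-- In Fourier coordinates the transversal Gaussian measure is a product of one-dimensional ones. -/
theorem map_ofLp_perpGaussian {L : ℝ} (hL : 0 < L) (hL' : L < 2 * Real.pi) (N : ℕ) :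
    (perpGaussian L N).map WithLp.ofLp =
      Measure.pi fun k : nonzeroModes N => gaussianReal 0 (modeVariance L k.1) := by
  have hv : ∀ k : nonzeroModes N, modeVariance L k.1 ≠ 0 := by
    intro k
    rw [← NNReal.coe_ne_zero, coe_modeVariance hL hL' (ne_zero_of_nonzeroModes k)]
    exact (one_div_pos.2 (eigenvalue_pos hL hL' (ne_zero_of_nonzeroModes k))).ne'
  have h1 : ∀ k : nonzeroModes N, gaussianReal 0 (modeVariance L k.1) =
      volume.withDensity fun x => ENNReal.ofReal (gaussianPDFReal 0 (modeVariance L k.1) x) :=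
    fun k => gaussianReal_of_var_ne_zero _ (hv k)
  simp only [h1]
  rw [pi_withDensity_ofReal (fun k => integrable_gaussianPDFReal _ _)
    (fun k x => gaussianPDFReal_nonneg _ _ _), perpGaussian]
  ext s hs
  have hmp := PiLp.volume_preserving_ofLp (nonzeroModes N)
  rw [Measure.map_apply (by fun_prop) hs, withDensity_apply _ hs,
    withDensity_apply _ (hs.preimage (by fun_prop)),
    ← hmp.setLIntegral_comp_preimage hs (by
      have := fun k : nonzeroModes N => measurable_gaussianPDFReal 0 (modeVariance L k.1)
      fun_prop)]
  refine lintegral_congr fun y => ?_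
  congr 1
  simp only [gaussianPDFReal, Finset.prod_mul_distrib, ← Real.exp_sum, ← Finset.prod_inv_distrib]
  congr 1
  · refine Finset.prod_congr rfl fun k _ => ?_
    rw [coe_modeVariance hL hL' (ne_zero_of_nonzeroModes k), mul_one_div]
  · rw [Finset.mul_sum, ← Finset.sum_neg_distrib]
    congr 1
    refine Finset.sum_congr rfl fun k _ => ?_
    have := eigenvalue_pos hL hL' (ne_zero_of_nonzeroModes k)
    rw [coe_modeVariance hL hL' (ne_zero_of_nonzeroModes k)]
    field_simp
    ring

theorem isProbabilityMeasure_perpGaussian {L : ℝ} (hL : 0 < L) (hL' : L < 2 * Real.pi) (N : ℕ) :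
    IsProbabilityMeasure (perpGaussian L N) := by
  have h := map_ofLp_perpGaussian hL hL' N
  have : IsProbabilityMeasure ((perpGaussian L N).map WithLp.ofLp) := by rw [h]; infer_instance
  exact Measure.isProbabilityMeasure_of_map (f := WithLp.ofLp) (μ := perpGaussian L N)

theorem map_eval_perpGaussian {L : ℝ} (hL : 0 < L) (hL' : L < 2 * Real.pi) {N : ℕ}
    (k : nonzeroModes N) :
    (perpGaussian L N).map (fun y => y k) = gaussianReal 0 (modeVariance L k.1) := by
  have h : (fun y : PerpSpace N => y k) = Function.eval k ∘ WithLp.ofLp := rfl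
  rw [h, ← Measure.map_map (by fun_prop) (by fun_prop), map_ofLp_perpGaussian hL hL',
    (measurePreserving_eval _ k).map_eq]

theorem iIndepFun_perpGaussian {L : ℝ} (hL : 0 < L) (hL' : L < 2 * Real.pi) (N : ℕ) :
    iIndepFun (fun (k : nonzeroModes N) (y : PerpSpace N) => y k) (perpGaussian L N) := by
  have := isProbabilityMeasure_perpGaussian hL hL' N
  rw [iIndepFun_iff_map_fun_eq_pi_map (fun k => by fun_prop)]
  simp only [map_eval_perpGaussian hL hL']
  exact map_ofLp_perpGaussian hL hL' N

theorem hasGaussianLaw_eval_perpGaussian {L : ℝ} (hL : 0 < L) (hL' : L < 2 * Real.pi) {N : ℕ}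
    (k : nonzeroModes N) : HasGaussianLaw (fun y : PerpSpace N => y k) (perpGaussian L N) :=
  ⟨by rw [map_eval_perpGaussian hL hL']; infer_instance⟩

theorem hasGaussianLaw_ofLp_perpGaussian {L : ℝ} (hL : 0 < L) (hL' : L < 2 * Real.pi) (N : ℕ) :
    HasGaussianLaw (fun (y : PerpSpace N) (k : nonzeroModes N) => y k) (perpGaussian L N) :=
  iIndepFun.hasGaussianLaw (hasGaussianLaw_eval_perpGaussian hL hL')
    (iIndepFun_perpGaussian hL hL' N)

theorem isGaussian_perpGaussian {L : ℝ} (hL : 0 < L) (hL' : L < 2 * Real.pi) (N : ℕ) :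
    IsGaussian (perpGaussian L N) := by
  have := (hasGaussianLaw_ofLp_perpGaussian hL hL' N).map_equiv_fun
    (PiLp.continuousLinearEquiv 2 ℝ fun _ : nonzeroModes N => ℝ).symm
  have h := this.isGaussian_map
  have h2 : (fun y : PerpSpace N => (PiLp.continuousLinearEquiv 2 ℝ fun _ : nonzeroModes N => ℝ).symm
    fun k => y k) = id := rfl
  rwa [h2, Measure.map_id] at h

theorem integral_eval_perpGaussian {L : ℝ} (hL : 0 < L) (hL' : L < 2 * Real.pi) {N : ℕ}
    (k : nonzeroModes N) : ∫ y : PerpSpace N, y k ∂perpGaussian L N = 0 := by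
  have h := integral_map (μ := perpGaussian L N) (φ := fun y : PerpSpace N => y k)
    (f := fun x : ℝ => x) (by fun_prop) (by fun_prop)
  rw [← h, map_eval_perpGaussian hL hL', integral_id_gaussianReal]

theorem covariance_eval_perpGaussian {L : ℝ} (hL : 0 < L) (hL' : L < 2 * Real.pi) {N : ℕ}
    (k l : nonzeroModes N) :
    cov[fun y : PerpSpace N => y k, fun y => y l; perpGaussian L N] =
      if k = l then 1 / eigenvalue L k.1 else 0 := by
  have := isProbabilityMeasure_perpGaussian hL hL' N
  split_ifs with h
  · subst h
    have h := variance_map (μ := perpGaussian L N) (X := fun x : ℝ => x)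
      (Y := fun y : PerpSpace N => y k) (by fun_prop) (by fun_prop)
    rw [map_eval_perpGaussian hL hL', variance_fun_id_gaussianReal,
      coe_modeVariance hL hL' (ne_zero_of_nonzeroModes k)] at h
    rw [covariance_self (by fun_prop), h]
    rfl
  · exact ((iIndepFun_perpGaussian hL hL' N).indepFun h).covariance_eq_zero
      (hasGaussianLaw_eval_perpGaussian hL hL' k).memLp_two
      (hasGaussianLaw_eval_perpGaussian hL hL' l).memLp_two

/-- The covariance of the transversal Gaussian field, i.e. the truncated Green function. -/
noncomputable def fieldCov (L : ℝ) (N : ℕ) (p q : ℝ × ℝ) : ℝ :=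
  (L ^ 2)⁻¹ * ∑ k ∈ nonzeroModes N, 1 / eigenvalue L k * Real.cos (phase L k p - phase L k q)

/-- The variance of the transversal Gaussian field at any point. -/
noncomputable def perpConst (L : ℝ) (N : ℕ) : ℝ :=
  (L ^ 2)⁻¹ * ∑ k ∈ nonzeroModes N, 1 / eigenvalue L k

theorem fieldCov_self (L : ℝ) (N : ℕ) (p : ℝ × ℝ) : fieldCov L N p p = perpConst L N := by
  simp [fieldCov, perpConst]

theorem eigenvalue_neg (L : ℝ) (k : ℤ × ℤ) : eigenvalue L (-k) = eigenvalue L k := by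
  simp [eigenvalue]

/-- Sums of odd functions over the nonzero modes vanish. -/
theorem sum_nonzeroModes_odd {N : ℕ} {f : ℤ × ℤ → ℝ} (hf : ∀ k, f (-k) = -f k) :
    ∑ k ∈ nonzeroModes N, f k = 0 := by
  have h : ∑ k ∈ nonzeroModes N, f k = ∑ k ∈ nonzeroModes N, f (-k) := by
    refine Finset.sum_nbij' (fun k => -k) (fun k => -k) ?_ ?_ ?_ ?_ ?_ <;>
      simp +contextual [nonzeroModes, neg_mem_modes]
  simp only [hf, Finset.sum_neg_distrib] at h
  linarith

/-- The counterterm exceeds the variance of the transversal field by the contribution of the mean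
mode. -/
theorem renormConst_eq {L : ℝ} (hL : 0 < L) (hL' : L < 2 * Real.pi) (N : ℕ) :
    renormConst L N = perpConst L N + (L ^ 2)⁻¹ := by
  have h0 : 1 / |eigenvalue L 0| = 1 := by simp [eigenvalue]
  have h1 : ∑ k ∈ nonzeroModes N, 1 / |eigenvalue L k| =
      ∑ k ∈ nonzeroModes N, 1 / eigenvalue L k :=
    Finset.sum_congr rfl fun k hk => by
      rw [abs_of_pos (eigenvalue_pos hL hL' (Finset.ne_of_mem_erase hk))]
  rw [renormConst, perpConst, ← h1, ← Finset.add_sum_erase _ _ (zero_mem_modes N), h0, nonzeroModes]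
  ring

theorem hasGaussianLaw_perpField {L : ℝ} (hL : 0 < L) (hL' : L < 2 * Real.pi) (N : ℕ)
    (p q : ℝ × ℝ) :
    HasGaussianLaw (fun y : PerpSpace N => (perpField L y p, perpField L y q))
      (perpGaussian L N) := by
  have h := (hasGaussianLaw_ofLp_perpGaussian hL hL' N).map_fun
    ((∑ k : nonzeroModes N, (L⁻¹ * cas L k.1 p) •
        ContinuousLinearMap.proj (R := ℝ) (φ := fun _ : nonzeroModes N => ℝ) k).prod
      (∑ k : nonzeroModes N, (L⁻¹ * cas L k.1 q) •
        ContinuousLinearMap.proj (R := ℝ) (φ := fun _ : nonzeroModes N => ℝ) k))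
  simpa [perpField, mul_comm] using h

theorem expectation_perpField {L : ℝ} (hL : 0 < L) (hL' : L < 2 * Real.pi) (N : ℕ) (p : ℝ × ℝ) :
    ∫ y : PerpSpace N, perpField L y p ∂perpGaussian L N = 0 := by
  simp only [perpField]
  rw [integral_finsetSum _ fun k _ =>
    ((hasGaussianLaw_eval_perpGaussian hL hL' k).integrable.mul_const _)]
  simp [integral_mul_const, integral_eval_perpGaussian hL hL']

theorem covariance_perpField {L : ℝ} (hL : 0 < L) (hL' : L < 2 * Real.pi) (N : ℕ)
    (p q : ℝ × ℝ) :
    cov[fun y : PerpSpace N => perpField L y p, fun y => perpField L y q; perpGaussian L N] =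
      fieldCov L N p q := by
  have := isProbabilityMeasure_perpGaussian hL hL' N
  simp only [perpField]
  rw [covariance_fun_sum_fun_sum
    (fun k => (hasGaussianLaw_eval_perpGaussian hL hL' k).memLp_two.mul_const _)
    (fun k => (hasGaussianLaw_eval_perpGaussian hL hL' k).memLp_two.mul_const _)]
  simp only [covariance_mul_const_left, covariance_mul_const_right,
    covariance_eval_perpGaussian hL hL']
  simp only [ite_mul, zero_mul, Finset.sum_ite_eq, Finset.mem_univ, if_true]
  have h := sum_nonzeroModes_odd (N := N)
    (f := fun k => 1 / eigenvalue L k * Real.sin (phase L k p + phase L k q)) (fun k => by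
      rw [eigenvalue_neg, phase_neg, phase_neg, ← neg_add, Real.sin_neg, mul_neg])
  have h2 : fieldCov L N p q = (L ^ 2)⁻¹ * ∑ k ∈ nonzeroModes N, (1 / eigenvalue L k *
      Real.cos (phase L k p - phase L k q) +
        1 / eigenvalue L k * Real.sin (phase L k p + phase L k q)) := by
    rw [Finset.sum_add_distrib, h, add_zero, fieldCov]
  rw [h2, ← Finset.sum_coe_sort (nonzeroModes N), Finset.mul_sum]
  refine Finset.sum_congr rfl fun k _ => ?_
  rw [← mul_add, ← cas_mul_cas]
  ring

/-! ### Uniform bound on the fourth power of the covariance -/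

/-- The cube root of the variance `1/λ_k`. -/
noncomputable def rootVariance (L : ℝ) (k : ℤ × ℤ) : ℝ := (1 / eigenvalue L k) ^ (1 / 3 : ℝ)

theorem norm_finTwoArrow_sq_le (k : ℤ × ℤ) :
    ‖(finTwoArrowEquiv ℤ).symm k‖ ^ 2 ≤ (k.1 : ℝ) ^ 2 + (k.2 : ℝ) ^ 2 := by
  have h : ‖(finTwoArrowEquiv ℤ).symm k‖ ≤ √((k.1 : ℝ) ^ 2 + (k.2 : ℝ) ^ 2) := by
    rw [pi_norm_le_iff_of_nonneg (Real.sqrt_nonneg _)]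
    intro i
    refine Real.le_sqrt_of_sq_le ?_
    fin_cases i <;> simp [Int.norm_eq_abs, sq_nonneg]
  calc _ ≤ √((k.1 : ℝ) ^ 2 + (k.2 : ℝ) ^ 2) ^ 2 := by gcongr
    _ = _ := Real.sq_sqrt (by positivity)

/-- The series `∑ λ_k ^ (-4/3)` converges in dimension two. -/
theorem exists_sum_rootVariance_le {L : ℝ} (hL : 0 < L) (hL' : L < 2 * Real.pi) :
    ∃ K : ℝ, 0 ≤ K ∧ ∀ N, ∑ k ∈ nonzeroModes N, rootVariance L k ^ 4 ≤ K := by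
  have h1 : 1 < (2 * Real.pi / L) ^ 2 := one_lt_pow₀ ((one_lt_div hL).2 hL') two_ne_zero
  set m := (2 * Real.pi / L) ^ 2 - 1 with hm
  have hm0 : 0 < m := by linarith
  have hs := EisensteinSeries.summable_one_div_norm_rpow (k := 8 / 3) (by norm_num)
  rw [← (finTwoArrowEquiv ℤ).symm.summable_iff] at hs
  have hs' := hs.mul_left (m ^ (-(4 / 3) : ℝ))
  refine ⟨∑' k : ℤ × ℤ, m ^ (-(4 / 3) : ℝ) * ‖(finTwoArrowEquiv ℤ).symm k‖ ^ (-(8 / 3) : ℝ),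
    tsum_nonneg fun k => by positivity, fun N => ?_⟩
  refine (Finset.sum_le_sum fun k hk => ?_).trans (hs'.sum_le_tsum (nonzeroModes N)
    fun k _ => by positivity)
  have hk0 : k ≠ 0 := Finset.ne_of_mem_erase hk
  have hpos := eigenvalue_pos hL hL' hk0
  set x := (finTwoArrowEquiv ℤ).symm k with hx
  have hx0 : 0 < ‖x‖ := by
    rw [norm_pos_iff, hx]
    intro h
    apply hk0
    have := congr_arg (finTwoArrowEquiv ℤ) h
    simpa [Prod.ext_iff] using this
  have hle : m * ‖x‖ ^ 2 ≤ eigenvalue L k := by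
    have hn := norm_finTwoArrow_sq_le k
    have h2 := one_le_sq_add_sq_of_ne_zero hk0
    have h3 := mul_le_mul_of_nonneg_left hn hm0.le
    have h4 : m * ((k.1 : ℝ) ^ 2 + (k.2 : ℝ) ^ 2) ≤ eigenvalue L k := by
      rw [eigenvalue, hm]; linarith
    exact h3.trans h4
  have e1 : rootVariance L k ^ 4 = eigenvalue L k ^ (-(4 / 3) : ℝ) := by
    rw [rootVariance, ← Real.rpow_natCast, ← Real.rpow_mul (one_div_pos.2 hpos).le, one_div,
      Real.inv_rpow hpos.le, ← Real.rpow_neg hpos.le]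
    norm_num
  have e2 : m ^ (-(4 / 3) : ℝ) * ‖x‖ ^ (-(8 / 3) : ℝ) = (m * ‖x‖ ^ 2) ^ (-(4 / 3) : ℝ) := by
    rw [Real.mul_rpow hm0.le (by positivity), ← Real.rpow_natCast ‖x‖ 2,
      ← Real.rpow_mul hx0.le]
    norm_num
  rw [e1, e2]
  exact Real.rpow_le_rpow_of_nonpos (by positivity) hle (by norm_num)

/-- If three indices determine the fourth one up to total weight one, a sum over quadruples of a
product over three indices is at most the cube of a single sum. -/
theorem sum_mul_resonance_le {ι : Type*} (S : Finset ι) {b : ι → ℝ} (hb : ∀ k, 0 ≤ b k)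
    {r : ι → ι → ι → ι → ℝ} (hr : ∀ i j k, ∑ l ∈ S, r i j k l ≤ 1) :
    ∑ i ∈ S, ∑ j ∈ S, ∑ k ∈ S, ∑ l ∈ S, b i * b j * b k * r i j k l ≤ (∑ k ∈ S, b k) ^ 3 := by
  have h : (∑ k ∈ S, b k) ^ 3 = ∑ i ∈ S, ∑ j ∈ S, ∑ k ∈ S, b i * b j * b k := by
    simp only [pow_succ, pow_zero, one_mul, Finset.sum_mul, Finset.mul_sum]
    rw [Finset.sum_comm]
    refine Finset.sum_congr rfl fun i _ => ?_
    rw [Finset.sum_comm]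
    refine Finset.sum_congr rfl fun i _ => Finset.sum_congr rfl fun i _ => by ring
  rw [h]
  refine Finset.sum_le_sum fun i _ => Finset.sum_le_sum fun j _ => Finset.sum_le_sum fun k _ => ?_
  rw [← Finset.mul_sum]
  exact mul_le_of_le_one_right (by have := hb i; have := hb j; have := hb k; positivity) (hr i j k)

theorem four_mul_prod_le (x y z w : ℝ) :
    4 * (x ^ 3 * y ^ 3 * z ^ 3 * w ^ 3) ≤
      (y * z * w) ^ 4 + (x * z * w) ^ 4 + (x * y * w) ^ 4 + (x * y * z) ^ 4 := by
  have key : ∀ p q r s : ℝ, 4 * (p * q * r * s) ≤ p ^ 4 + q ^ 4 + r ^ 4 + s ^ 4 := by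
    intro p q r s
    nlinarith [sq_nonneg (p ^ 2 - q ^ 2), sq_nonneg (r ^ 2 - s ^ 2), sq_nonneg (p * q - r * s)]
  have := key (y * z * w) (x * z * w) (x * y * w) (x * y * z)
  linarith

/-- A discrete Brascamp-Lieb inequality: the sum over resonant quadruples is controlled by the
`ℓ^(4/3)` norm, since the arithmetic-geometric mean inequality distributes each quadruple product
over its four triples, and a triple determines the remaining index. -/
theorem sum_resonant_le {ι : Type*} [AddCommGroup ι] [DecidableEq ι] (S : Finset ι) {b : ι → ℝ} :
    ∑ i ∈ S, ∑ j ∈ S, ∑ k ∈ S, ∑ l ∈ S, b i ^ 3 * b j ^ 3 * b k ^ 3 * b l ^ 3 *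
      (if i + j + (k + l) = 0 then 1 else 0) ≤ (∑ k ∈ S, b k ^ 4) ^ 3 := by
  set r : ι → ι → ι → ι → ℝ := fun i j k l => if i + j + (k + l) = 0 then 1 else 0 with hr
  have hr0 : ∀ i j k l, 0 ≤ r i j k l := fun i j k l => by simp only [hr]; split_ifs <;> norm_num
  have hr1 : ∀ i j k, ∑ l ∈ S, r i j k l ≤ 1 := by
    intro i j k
    have : ∀ l, r i j k l = if l = -(i + j + k) then 1 else 0 := by
      intro l
      simp only [hr]
      congr 1
      rw [← add_assoc, add_eq_zero_iff_eq_neg']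
    simp only [this, Finset.sum_ite_eq']
    split_ifs <;> norm_num
  have hb4 : ∀ k, 0 ≤ b k ^ 4 := fun k => by positivity
  have hsym1 : ∀ i j k l, r i j k l = r i j l k := fun i j k l => by
    simp only [hr, add_comm k l]
  have hsym2 : ∀ i j k l, r i j k l = r k l i j := fun i j k l => by
    simp only [hr, add_comm (k + l)]
  have hsym3 : ∀ i j k l, r i j k l = r j i k l := fun i j k l => by
    simp only [hr, add_comm i j]
  have t4 := sum_mul_resonance_le S hb4 hr1
  have t3 : ∑ i ∈ S, ∑ j ∈ S, ∑ k ∈ S, ∑ l ∈ S, b i ^ 4 * b j ^ 4 * b l ^ 4 * r i j k l ≤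
      (∑ k ∈ S, b k ^ 4) ^ 3 := by
    refine le_trans (le_of_eq ?_) t4
    refine Finset.sum_congr rfl fun i _ => Finset.sum_congr rfl fun j _ => ?_
    rw [Finset.sum_comm]
    refine Finset.sum_congr rfl fun k _ => Finset.sum_congr rfl fun l _ => ?_
    rw [hsym1]
  have t2 : ∑ i ∈ S, ∑ j ∈ S, ∑ k ∈ S, ∑ l ∈ S, b i ^ 4 * b k ^ 4 * b l ^ 4 * r i j k l ≤
      (∑ k ∈ S, b k ^ 4) ^ 3 := by
    refine le_trans (le_of_eq ?_) t4
    have : ∀ F : ι → ι → ι → ι → ℝ, ∑ i ∈ S, ∑ j ∈ S, ∑ k ∈ S, ∑ l ∈ S, F i j k l =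
        ∑ k ∈ S, ∑ l ∈ S, ∑ i ∈ S, ∑ j ∈ S, F i j k l := by
      intro F
      calc _ = ∑ i ∈ S, ∑ k ∈ S, ∑ j ∈ S, ∑ l ∈ S, F i j k l :=
            Finset.sum_congr rfl fun i _ => Finset.sum_comm
        _ = ∑ k ∈ S, ∑ i ∈ S, ∑ j ∈ S, ∑ l ∈ S, F i j k l := Finset.sum_comm
        _ = ∑ k ∈ S, ∑ i ∈ S, ∑ l ∈ S, ∑ j ∈ S, F i j k l :=
            Finset.sum_congr rfl fun i _ => Finset.sum_congr rfl fun j _ => Finset.sum_comm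
        _ = _ := Finset.sum_congr rfl fun i _ => Finset.sum_comm
    rw [this]
    refine Finset.sum_congr rfl fun k _ => Finset.sum_congr rfl fun l _ =>
      Finset.sum_congr rfl fun i _ => Finset.sum_congr rfl fun j _ => ?_
    rw [hsym2]; ring
  have t1 : ∑ i ∈ S, ∑ j ∈ S, ∑ k ∈ S, ∑ l ∈ S, b j ^ 4 * b k ^ 4 * b l ^ 4 * r i j k l ≤
      (∑ k ∈ S, b k ^ 4) ^ 3 := by
    refine le_trans (le_of_eq ?_) t2
    rw [Finset.sum_comm]
    refine Finset.sum_congr rfl fun i _ => Finset.sum_congr rfl fun j _ =>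
      Finset.sum_congr rfl fun k _ => Finset.sum_congr rfl fun l _ => ?_
    rw [hsym3]
  have hsum : 4 * ∑ i ∈ S, ∑ j ∈ S, ∑ k ∈ S, ∑ l ∈ S,
      b i ^ 3 * b j ^ 3 * b k ^ 3 * b l ^ 3 * r i j k l ≤
      (∑ i ∈ S, ∑ j ∈ S, ∑ k ∈ S, ∑ l ∈ S, b j ^ 4 * b k ^ 4 * b l ^ 4 * r i j k l) +
      (∑ i ∈ S, ∑ j ∈ S, ∑ k ∈ S, ∑ l ∈ S, b i ^ 4 * b k ^ 4 * b l ^ 4 * r i j k l) +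
      (∑ i ∈ S, ∑ j ∈ S, ∑ k ∈ S, ∑ l ∈ S, b i ^ 4 * b j ^ 4 * b l ^ 4 * r i j k l) +
      ∑ i ∈ S, ∑ j ∈ S, ∑ k ∈ S, ∑ l ∈ S, b i ^ 4 * b j ^ 4 * b k ^ 4 * r i j k l := by
    simp only [Finset.mul_sum, ← Finset.sum_add_distrib]
    refine Finset.sum_le_sum fun i _ => Finset.sum_le_sum fun j _ =>
      Finset.sum_le_sum fun k _ => Finset.sum_le_sum fun l _ => ?_
    have := mul_le_mul_of_nonneg_right (four_mul_prod_le (b i) (b j) (b k) (b l)) (hr0 i j k l)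
    linarith
  linarith

theorem sum_cos_mul_sum_cos {ι κ : Type*} (S : Finset ι) (T : Finset κ) {a t : ι → ℝ}
    {b u : κ → ℝ} (ha : ∑ i ∈ S, a i * Real.sin (t i) = 0) :
    (∑ i ∈ S, a i * Real.cos (t i)) * (∑ j ∈ T, b j * Real.cos (u j)) =
      ∑ x ∈ S ×ˢ T, a x.1 * b x.2 * Real.cos (t x.1 + u x.2) := by
  have h : ∑ x ∈ S ×ˢ T, a x.1 * b x.2 * Real.cos (t x.1 + u x.2) =
      (∑ i ∈ S, a i * Real.cos (t i)) * (∑ j ∈ T, b j * Real.cos (u j)) -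
      (∑ i ∈ S, a i * Real.sin (t i)) * (∑ j ∈ T, b j * Real.sin (u j)) := by
    rw [Finset.sum_mul_sum, Finset.sum_mul_sum, Finset.sum_product, ← Finset.sum_sub_distrib]
    refine Finset.sum_congr rfl fun i _ => ?_
    rw [← Finset.sum_sub_distrib]
    refine Finset.sum_congr rfl fun j _ => ?_
    rw [Real.cos_add]; ring
  rw [h, ha]; ring

theorem sum_sin_add_eq_zero {ι κ : Type*} (S : Finset ι) (T : Finset κ) {a t : ι → ℝ}
    {b u : κ → ℝ} (ha : ∑ i ∈ S, a i * Real.sin (t i) = 0)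
    (hb : ∑ j ∈ T, b j * Real.sin (u j) = 0) :
    ∑ x ∈ S ×ˢ T, a x.1 * b x.2 * Real.sin (t x.1 + u x.2) = 0 := by
  have h : ∑ x ∈ S ×ˢ T, a x.1 * b x.2 * Real.sin (t x.1 + u x.2) =
      (∑ i ∈ S, a i * Real.sin (t i)) * (∑ j ∈ T, b j * Real.cos (u j)) +
      (∑ i ∈ S, a i * Real.cos (t i)) * (∑ j ∈ T, b j * Real.sin (u j)) := by
    rw [Finset.sum_mul_sum, Finset.sum_mul_sum, Finset.sum_product, ← Finset.sum_add_distrib]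
    refine Finset.sum_congr rfl fun i _ => ?_
    rw [← Finset.sum_add_distrib]
    refine Finset.sum_congr rfl fun j _ => ?_
    rw [Real.sin_add]; ring
  rw [h, ha, hb]; ring

theorem sum_cos_pow_four {ι : Type*} (S : Finset ι) {a t : ι → ℝ}
    (ha : ∑ i ∈ S, a i * Real.sin (t i) = 0) :
    (∑ i ∈ S, a i * Real.cos (t i)) ^ 4 = ∑ i ∈ S, ∑ j ∈ S, ∑ k ∈ S, ∑ l ∈ S,
      a i * a j * a k * a l * Real.cos (t i + t j + (t k + t l)) := by
  have h2 := sum_cos_mul_sum_cos S S (b := a) (u := t) ha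
  have h4 := sum_cos_mul_sum_cos (S ×ˢ S) (S ×ˢ S) (b := fun x => a x.1 * a x.2)
    (u := fun x => t x.1 + t x.2) (sum_sin_add_eq_zero S S ha ha)
  rw [← h2] at h4
  calc _ = _ := by ring
    _ = _ := h4
    _ = _ := by
      simp only [Finset.sum_product]
      refine Finset.sum_congr rfl fun i _ => Finset.sum_congr rfl fun j _ =>
        Finset.sum_congr rfl fun k _ => Finset.sum_congr rfl fun l _ => by ring

theorem integral_cos_phase_sub {L : ℝ} (hL : 0 < L) (k : ℤ × ℤ) (q : ℝ × ℝ) :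
    ∫ p, Real.cos (phase L k p - phase L k q) ∂torusMeasure L = if k = 0 then L ^ 2 else 0 := by
  simp only [Real.cos_sub]
  rw [integral_add (integrable_torusMeasure (by fun_prop)) (integrable_torusMeasure (by fun_prop)),
    integral_mul_const, integral_mul_const, integral_cos_phase hL, integral_sin_phase hL]
  split_ifs with h <;> simp [h, phase]

@[fun_prop]
theorem continuous_fieldCov (L : ℝ) (N : ℕ) :
    Continuous fun x : (ℝ × ℝ) × (ℝ × ℝ) => fieldCov L N x.1 x.2 := by
  unfold fieldCov phase; fun_prop

theorem integral_fieldCov_pow_four_le {L : ℝ} (hL : 0 < L) (hL' : L < 2 * Real.pi) (N : ℕ)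
    (q : ℝ × ℝ) :
    ∫ p, fieldCov L N p q ^ 4 ∂torusMeasure L ≤
      ((L ^ 2)⁻¹) ^ 3 * (∑ k ∈ nonzeroModes N, rootVariance L k ^ 4) ^ 3 := by
  have hodd : ∀ p, ∑ k ∈ nonzeroModes N, 1 / eigenvalue L k *
      Real.sin (phase L k p - phase L k q) = 0 := fun p => sum_nonzeroModes_odd fun k => by
    rw [eigenvalue_neg, phase_neg, phase_neg, ← neg_sub', Real.sin_neg, mul_neg]
  have h : ∀ p, fieldCov L N p q ^ 4 = ((L ^ 2)⁻¹) ^ 4 * ∑ i ∈ nonzeroModes N,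
      ∑ j ∈ nonzeroModes N, ∑ k ∈ nonzeroModes N, ∑ l ∈ nonzeroModes N,
      1 / eigenvalue L i * (1 / eigenvalue L j) * (1 / eigenvalue L k) * (1 / eigenvalue L l) *
        Real.cos (phase L (i + j + (k + l)) p - phase L (i + j + (k + l)) q) := by
    intro p
    rw [fieldCov, mul_pow, sum_cos_pow_four _ (hodd p)]
    congr 1
    refine Finset.sum_congr rfl fun i _ => Finset.sum_congr rfl fun j _ =>
        Finset.sum_congr rfl fun k _ => Finset.sum_congr rfl fun l _ => ?_
    simp only [phase_add]
    congr 2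
    ring
  simp only [h]
  rw [integral_const_mul, integral_finsetSum _ fun i _ => integrable_torusMeasure (by fun_prop)]
  have h2 : ∑ i ∈ nonzeroModes N, ∫ p, ∑ j ∈ nonzeroModes N, ∑ k ∈ nonzeroModes N,
      ∑ l ∈ nonzeroModes N,
      1 / eigenvalue L i * (1 / eigenvalue L j) * (1 / eigenvalue L k) * (1 / eigenvalue L l) *
        Real.cos (phase L (i + j + (k + l)) p - phase L (i + j + (k + l)) q) ∂torusMeasure L =
      L ^ 2 * ∑ i ∈ nonzeroModes N, ∑ j ∈ nonzeroModes N, ∑ k ∈ nonzeroModes N,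
        ∑ l ∈ nonzeroModes N, rootVariance L i ^ 3 * rootVariance L j ^ 3 *
          rootVariance L k ^ 3 * rootVariance L l ^ 3 *
          (if i + j + (k + l) = 0 then 1 else 0) := by
    have hroot : ∀ k ∈ nonzeroModes N, rootVariance L k ^ 3 = 1 / eigenvalue L k := by
      intro k hk
      have := (one_div_pos.2 (eigenvalue_pos hL hL' (Finset.ne_of_mem_erase hk))).le
      rw [rootVariance, ← Real.rpow_natCast, ← Real.rpow_mul this]
      norm_num
    simp only [Finset.mul_sum]
    refine Finset.sum_congr rfl fun i hi => ?_
    rw [integral_finsetSum _ fun i _ => integrable_torusMeasure (by fun_prop)]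
    refine Finset.sum_congr rfl fun j hj => ?_
    rw [integral_finsetSum _ fun i _ => integrable_torusMeasure (by fun_prop)]
    refine Finset.sum_congr rfl fun k hk => ?_
    rw [integral_finsetSum _ fun i _ => integrable_torusMeasure (by fun_prop)]
    refine Finset.sum_congr rfl fun l hl => ?_
    rw [integral_const_mul, integral_cos_phase_sub hL, hroot i hi, hroot j hj, hroot k hk,
      hroot l hl]
    split_ifs <;> ring
  rw [h2]
  calc _ ≤ ((L ^ 2)⁻¹) ^ 4 * (L ^ 2 * (∑ k ∈ nonzeroModes N, rootVariance L k ^ 4) ^ 3) := by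
        gcongr
        exact sum_resonant_le _
    _ = _ := by field_simp

/-! ### Second moments of the integrated Wick powers -/

theorem abs_cas_le (L : ℝ) (k : ℤ × ℤ) (p : ℝ × ℝ) : |cas L k p| ≤ 2 := by
  have h1 := abs_add_le (Real.cos (phase L k p)) (Real.sin (phase L k p))
  have h2 := Real.abs_cos_le_one (phase L k p)
  have h3 := Real.abs_sin_le_one (phase L k p)
  unfold cas
  linarith

theorem exists_abs_perpField_le (L : ℝ) (N : ℕ) :
    ∃ M : ℝ, 0 ≤ M ∧ ∀ (y : PerpSpace N) p, |perpField L y p| ≤ M * ‖y‖ := by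
  refine ⟨∑ k : nonzeroModes N, |L⁻¹| * 2, by positivity, fun y p => ?_⟩
  rw [perpField, Finset.sum_mul]
  refine (Finset.abs_sum_le_sum_abs _ _).trans (Finset.sum_le_sum fun k _ => ?_)
  rw [abs_mul, abs_mul, mul_comm]
  have h1 : |y k| ≤ ‖y‖ := PiLp.norm_apply_le y k
  have h2 := abs_cas_le L k.1 p
  gcongr

@[fun_prop]
theorem continuous_perpField_uncurry (L : ℝ) (N : ℕ) :
    Continuous fun x : PerpSpace N × (ℝ × ℝ) => perpField L x.1 x.2 := by
  unfold perpField; fun_prop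

theorem integrable_one_add_norm_pow {E : Type*} [NormedAddCommGroup E] [NormedSpace ℝ E]
    [MeasurableSpace E] [BorelSpace E] [SecondCountableTopology E] [CompleteSpace E]
    (P : Measure E) [IsGaussian P] {n : ℕ} (hn : n ≠ 0) :
    Integrable (fun y => (1 + ‖y‖) ^ n) P := by
  have h1 : MemLp id (n : ℝ≥0∞) P := IsGaussian.memLp_id P n (ENNReal.natCast_ne_top n)
  have h2 : MemLp (fun y : E => ‖y‖) (n : ℝ≥0∞) P := h1.norm
  have h3 : MemLp (fun _ : E => (1 : ℝ)) (n : ℝ≥0∞) P := memLp_const 1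
  have h := h3.add h2
  refine (h.integrable_norm_pow hn).congr (Eventually.of_forall fun y => ?_)
  have : 0 ≤ 1 + ‖y‖ := by positivity
  simp [abs_of_nonneg this]

/-- The second moment of the torus integral of a functional of the Gaussian field is the double
torus integral of its two-point function. -/
theorem integral_sq_torus_functional {L : ℝ} (hL : 0 < L) (hL' : L < 2 * Real.pi) (N : ℕ)
    {w : ℝ → ℝ} (hw : Continuous w) {C : ℝ} (hC : ∀ t, |w t| ≤ C * (1 + |t|) ^ 4) :
    Integrable (fun y : PerpSpace N => (∫ p, w (perpField L y p) ∂torusMeasure L) ^ 2)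
        (perpGaussian L N) ∧
      ∫ y : PerpSpace N, (∫ p, w (perpField L y p) ∂torusMeasure L) ^ 2 ∂perpGaussian L N =
        ∫ x : (ℝ × ℝ) × (ℝ × ℝ), (∫ y : PerpSpace N, w (perpField L y x.1) * w (perpField L y x.2)
          ∂perpGaussian L N) ∂(torusMeasure L).prod (torusMeasure L) := by
  have := isProbabilityMeasure_perpGaussian hL hL' N
  have := isGaussian_perpGaussian hL hL' N
  obtain ⟨M, hM, hbound⟩ := exists_abs_perpField_le L N
  have hC0 : 0 ≤ C := by simpa using (abs_nonneg _).trans (hC 0)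
  have hwb : ∀ (y : PerpSpace N) p, |w (perpField L y p)| ≤ C * ((1 + M) * (1 + ‖y‖)) ^ 4 := by
    intro y p
    refine (hC _).trans ?_
    have : 1 + |perpField L y p| ≤ (1 + M) * (1 + ‖y‖) := by
      nlinarith [hbound y p, norm_nonneg y]
    gcongr
  have hint : Integrable (fun z : PerpSpace N × ((ℝ × ℝ) × (ℝ × ℝ)) =>
      w (perpField L z.1 z.2.1) * w (perpField L z.1 z.2.2))
      ((perpGaussian L N).prod ((torusMeasure L).prod (torusMeasure L))) := by
    have hb : Integrable (fun z : PerpSpace N × ((ℝ × ℝ) × (ℝ × ℝ)) =>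
        (1 + ‖z.1‖) ^ 8 * (C * (1 + M) ^ 4) ^ 2)
        ((perpGaussian L N).prod ((torusMeasure L).prod (torusMeasure L))) :=
      Integrable.mul_prod (g := fun _ : (ℝ × ℝ) × (ℝ × ℝ) => (C * (1 + M) ^ 4) ^ 2)
        (integrable_one_add_norm_pow (perpGaussian L N) (by norm_num : 8 ≠ 0))
        (integrable_const _)
    refine hb.mono' ?_ (Eventually.of_forall fun z => ?_)
    · have h1 : Continuous fun z : PerpSpace N × ((ℝ × ℝ) × (ℝ × ℝ)) => perpField L z.1 z.2.1 :=
        (continuous_perpField_uncurry L N).comp (by fun_prop : Continuous fun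
          z : PerpSpace N × ((ℝ × ℝ) × (ℝ × ℝ)) => (z.1, z.2.1))
      have h2 : Continuous fun z : PerpSpace N × ((ℝ × ℝ) × (ℝ × ℝ)) => perpField L z.1 z.2.2 :=
        (continuous_perpField_uncurry L N).comp (by fun_prop : Continuous fun
          z : PerpSpace N × ((ℝ × ℝ) × (ℝ × ℝ)) => (z.1, z.2.2))
      exact ((hw.comp h1).mul (hw.comp h2)).aestronglyMeasurable
    · rw [Real.norm_eq_abs, abs_mul]
      calc _ ≤ (C * ((1 + M) * (1 + ‖z.1‖)) ^ 4) * (C * ((1 + M) * (1 + ‖z.1‖)) ^ 4) :=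
            mul_le_mul (hwb _ _) (hwb _ _) (abs_nonneg _) (by positivity)
        _ = _ := by ring
  have hsq : ∀ y : PerpSpace N, (∫ p, w (perpField L y p) ∂torusMeasure L) ^ 2 =
      ∫ x : (ℝ × ℝ) × (ℝ × ℝ), w (perpField L y x.1) * w (perpField L y x.2)
        ∂(torusMeasure L).prod (torusMeasure L) := by
    intro y
    rw [sq, integral_prod_mul (fun p => w (perpField L y p)) (fun p => w (perpField L y p))]
  simp only [hsq]
  exact ⟨hint.integral_prod_left, integral_integral_swap hint⟩

theorem integrable_fieldCov_pow_four (L : ℝ) (N : ℕ) :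
    Integrable (fun x : (ℝ × ℝ) × (ℝ × ℝ) => fieldCov L N x.1 x.2 ^ 4)
      ((torusMeasure L).prod (torusMeasure L)) := by
  have hb : ∀ p q, |fieldCov L N p q| ≤
      |(L ^ 2)⁻¹| * ∑ k ∈ nonzeroModes N, |1 / eigenvalue L k| := by
    intro p q
    rw [fieldCov, abs_mul]
    gcongr
    refine (Finset.abs_sum_le_sum_abs _ _).trans (Finset.sum_le_sum fun k _ => ?_)
    rw [abs_mul]
    exact mul_le_of_le_one_right (abs_nonneg _) (Real.abs_cos_le_one _)
  refine Integrable.mono' (integrable_const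
    ((|(L ^ 2)⁻¹| * ∑ k ∈ nonzeroModes N, |1 / eigenvalue L k|) ^ 4))
    ((continuous_fieldCov L N).pow 4).aestronglyMeasurable (Eventually.of_forall fun x => ?_)
  rw [Real.norm_eq_abs, abs_pow]
  gcongr
  exact hb _ _

/-- A functional whose two-point function is bounded by the fourth power of the covariance has a
torus integral with second moment bounded uniformly in the truncation `N`. -/
theorem exists_second_moment_le {L : ℝ} (hL : 0 < L) (hL' : L < 2 * Real.pi) :
    ∃ K : ℝ, 0 ≤ K ∧ ∀ (N : ℕ) (w : ℝ → ℝ), Continuous w →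
      (∃ C : ℝ, ∀ t, |w t| ≤ C * (1 + |t|) ^ 4) →
      (∀ p q, ∫ y : PerpSpace N, w (perpField L y p) * w (perpField L y q) ∂perpGaussian L N ≤
        24 * (1 + fieldCov L N p q ^ 4)) →
      Integrable (fun y : PerpSpace N => (∫ p, w (perpField L y p) ∂torusMeasure L) ^ 2)
        (perpGaussian L N) ∧
      ∫ y : PerpSpace N, (∫ p, w (perpField L y p) ∂torusMeasure L) ^ 2 ∂perpGaussian L N ≤ K := by
  obtain ⟨K, hK, hKN⟩ := exists_sum_rootVariance_le hL hL'
  refine ⟨24 * (L ^ 4 + L ^ 2 * (((L ^ 2)⁻¹) ^ 3 * K ^ 3)), by positivity, ?_⟩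
  rintro N w hw ⟨C, hC⟩ hcov
  obtain ⟨h1, h2⟩ := integral_sq_torus_functional hL hL' N hw hC
  refine ⟨h1, ?_⟩
  have hint4 := integrable_fieldCov_pow_four L N
  have hint : Integrable (fun x : (ℝ × ℝ) × (ℝ × ℝ) => 24 * (1 + fieldCov L N x.1 x.2 ^ 4))
      ((torusMeasure L).prod (torusMeasure L)) :=
    ((integrable_const 1).add hint4).const_mul 24
  have hle : ∫ x : (ℝ × ℝ) × (ℝ × ℝ), fieldCov L N x.1 x.2 ^ 4
      ∂(torusMeasure L).prod (torusMeasure L) ≤ L ^ 2 * (((L ^ 2)⁻¹) ^ 3 * K ^ 3) := by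
    rw [integral_prod_symm _ hint4]
    calc _ ≤ ∫ _ : ℝ × ℝ, ((L ^ 2)⁻¹) ^ 3 * K ^ 3 ∂torusMeasure L := by
          refine integral_mono hint4.integral_prod_right (integrable_const _) fun q => ?_
          refine (integral_fieldCov_pow_four_le hL hL' N q).trans ?_
          have : 0 ≤ ∑ k ∈ nonzeroModes N, rootVariance L k ^ 4 := by positivity
          gcongr
          exact hKN N
      _ = _ := by
          rw [integral_const, torusMeasure_real_univ hL, smul_eq_mul]
  rw [h2]
  by_cases hi : Integrable (fun x : (ℝ × ℝ) × (ℝ × ℝ) => ∫ y : PerpSpace N,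
      w (perpField L y x.1) * w (perpField L y x.2) ∂perpGaussian L N)
      ((torusMeasure L).prod (torusMeasure L))
  · refine (integral_mono hi hint fun x => hcov x.1 x.2).trans ?_
    rw [integral_const_mul, integral_add (integrable_const _) hint4, integral_const,
      ← univ_prod_univ, measureReal_prod_prod, torusMeasure_real_univ hL, smul_eq_mul]
    linarith
  · rw [integral_undef hi]; positivity

/-- The integrated Wick powers of orders two to four have second moments bounded uniformly in the
truncation `N`. -/
theorem exists_wick_second_moments {L : ℝ} (hL : 0 < L) (hL' : L < 2 * Real.pi) :
    ∃ K : ℝ, 0 ≤ K ∧ ∀ (N : ℕ), ∀ w ∈ ({wickTwo (perpConst L N), wickThree (perpConst L N),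
        wickFour (perpConst L N)} : Set (ℝ → ℝ)),
      Integrable (fun y : PerpSpace N => (∫ p, w (perpField L y p) ∂torusMeasure L) ^ 2)
        (perpGaussian L N) ∧
      ∫ y : PerpSpace N, (∫ p, w (perpField L y p) ∂torusMeasure L) ^ 2 ∂perpGaussian L N ≤ K := by
  obtain ⟨K, hK, h⟩ := exists_second_moment_le hL hL'
  refine ⟨K, hK, fun N w hw => ?_⟩
  have := isProbabilityMeasure_perpGaussian hL hL' N
  have hvar : ∀ p, Var[fun y : PerpSpace N => perpField L y p; perpGaussian L N] =
      perpConst L N := fun p => by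
    rw [← covariance_self (hasGaussianLaw_perpField hL hL' N p p).fst.aemeasurable,
      covariance_perpField hL hL', fieldCov_self]
  have hwick : ∀ p q, _ := fun p q => integral_wick_mul_wick (hasGaussianLaw_perpField hL hL' N p q)
    (expectation_perpField hL hL' N p) (expectation_perpField hL hL' N q) (hvar p) (hvar q)
  simp only [covariance_perpField hL hL'] at hwick
  set c := perpConst L N with hc
  have hpow : ∀ t : ℝ, (1 ≤ (1 + |t|) ^ 4) ∧ (|t| ≤ (1 + |t|) ^ 4) ∧ (|t| ^ 2 ≤ (1 + |t|) ^ 4) ∧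
      (|t| ^ 3 ≤ (1 + |t|) ^ 4) ∧ |t| ^ 4 ≤ (1 + |t|) ^ 4 := by
    intro t
    have h0 := abs_nonneg t
    have e : (1 + |t|) ^ 4 = 1 + 4 * |t| + 6 * |t| ^ 2 + 4 * |t| ^ 3 + |t| ^ 4 := by ring
    have h2 : 0 ≤ |t| ^ 2 := by positivity
    have h3 : 0 ≤ |t| ^ 3 := by positivity
    have h4 : 0 ≤ |t| ^ 4 := by positivity
    rw [e]
    refine ⟨?_, ?_, ?_, ?_, ?_⟩ <;> linarith
  have hc0 := abs_nonneg c
  rcases hw with rfl | rfl | rfl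
  · refine h N _ (by unfold wickTwo; fun_prop) ⟨1 + |c|, fun t => ?_⟩ fun p q => ?_
    · obtain ⟨p0, p1, p2, p3, p4⟩ := hpow t
      have e := abs_sub (t ^ 2) c
      rw [abs_pow] at e
      unfold wickTwo
      nlinarith
    · rw [(hwick p q).1]
      nlinarith [sq_nonneg (fieldCov L N p q ^ 2 - 1), sq_nonneg (fieldCov L N p q)]
  · refine h N _ (by unfold wickThree; fun_prop) ⟨1 + 3 * |c|, fun t => ?_⟩ fun p q => ?_
    · obtain ⟨p0, p1, p2, p3, p4⟩ := hpow t
      have e := abs_sub (t ^ 3) (3 * c * t)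
      rw [abs_pow, abs_mul, abs_mul, abs_of_pos (by norm_num : (0 : ℝ) < 3)] at e
      unfold wickThree
      nlinarith
    · rw [(hwick p q).2.1]
      nlinarith [sq_nonneg (fieldCov L N p q ^ 2 - fieldCov L N p q),
        sq_nonneg (fieldCov L N p q ^ 2 - 1), sq_nonneg (fieldCov L N p q)]
  · refine h N _ (by unfold wickFour; fun_prop) ⟨1 + 6 * |c| + 3 * |c| ^ 2, fun t => ?_⟩
      fun p q => ?_
    · obtain ⟨p0, p1, p2, p3, p4⟩ := hpow t
      have e := abs_add_le (t ^ 4 - 6 * c * t ^ 2) (3 * c ^ 2)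
      have e2 := abs_sub (t ^ 4) (6 * c * t ^ 2)
      rw [abs_pow, abs_mul, abs_mul, abs_pow, abs_of_pos (by norm_num : (0 : ℝ) < 6)] at e2
      rw [abs_mul, abs_pow, abs_of_pos (by norm_num : (0 : ℝ) < 3)] at e
      have := mul_le_mul_of_nonneg_left p2 hc0
      have := mul_le_mul_of_nonneg_left p0 (sq_nonneg |c|)
      unfold wickFour
      linarith
    · rw [(hwick p q).2.2]
      nlinarith

/-! ### The rescaled potential and the one-dimensional partition function -/

/-- The torus integral of the second Wick power of the transversal field. -/
noncomputable def wickInt₂ (L : ℝ) {N : ℕ} (y : PerpSpace N) : ℝ :=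
  ∫ p, wickTwo (perpConst L N) (perpField L y p) ∂torusMeasure L

/-- The torus integral of the third Wick power of the transversal field. -/
noncomputable def wickInt₃ (L : ℝ) {N : ℕ} (y : PerpSpace N) : ℝ :=
  ∫ p, wickThree (perpConst L N) (perpField L y p) ∂torusMeasure L

/-- The torus integral of the fourth Wick power of the transversal field. -/
noncomputable def wickInt₄ (L : ℝ) {N : ℕ} (y : PerpSpace N) : ℝ :=
  ∫ p, wickFour (perpConst L N) (perpField L y p) ∂torusMeasure L

/-- The interaction terms of the rescaled potential which involve the mean mode `t`, with
`Q = ∫ (φ_⊥² - C_N)` and `T = ∫ φ_⊥³`. -/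
noncomputable def meanInteraction (L Q T t : ℝ) : ℝ :=
  t ^ 4 / (4 * L ^ 2) + 3 / (2 * L ^ 2) * t ^ 2 * Q + t / L * T

/-- In the coordinates rescaled by `√ε`, the potential is quadratic up to a perturbation of size `ε`
which is a combination of integrated Wick powers of the transversal field. -/
theorem potential_div_eq {L : ℝ} (hL : 0 < L) (hL' : L < 2 * Real.pi) {ε : ℝ} (hε : 0 < ε) {N : ℕ}
    {z : Space N} {t : ℝ} {y : PerpSpace N} (hz : zeroCoord z = √ε * t)
    (hy : perpPart z = √ε • y) :
    potential L ε N z / ε = -(t ^ 2 / 2) +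
      1 / 2 * ∑ k : nonzeroModes N, eigenvalue L k.1 * y k ^ 2 +
      ε * (meanInteraction L (wickInt₂ L y - 1) (wickInt₃ L y) t +
        (wickInt₄ L y - 6 / L ^ 2 * wickInt₂ L y + 3 / L ^ 2) / 4) := by
  have hs : √ε ^ 2 = ε := Real.sq_sqrt hε.le
  have hs4 : √ε ^ 4 = ε ^ 2 := by rw [show (4 : ℕ) = 2 * 2 from rfl, pow_mul, hs]
  set c := perpConst L N with hc
  have hfield : ∀ p, perpField L (√ε • y) p = √ε * perpField L y p := by
    intro p
    simp [perpField, Finset.mul_sum, mul_assoc]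
  have i1 : Integrable (fun p => perpField L y p) (torusMeasure L) :=
    integrable_torusMeasure (by fun_prop)
  have i2 : Integrable (fun p => perpField L y p ^ 2) (torusMeasure L) :=
    integrable_torusMeasure (by fun_prop)
  have i3 : Integrable (fun p => perpField L y p ^ 3) (torusMeasure L) :=
    integrable_torusMeasure (by fun_prop)
  have i4 : Integrable (fun p => perpField L y p ^ 4) (torusMeasure L) :=
    integrable_torusMeasure (by fun_prop)
  have m1 := integral_perpField hL y
  have hint : ∀ a₀ a₁ a₂ a₃ a₄ : ℝ, ∫ p, (a₀ + a₁ * perpField L y p + a₂ * perpField L y p ^ 2 +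
      a₃ * perpField L y p ^ 3 + a₄ * perpField L y p ^ 4) ∂torusMeasure L =
      a₀ * L ^ 2 + a₂ * (∫ p, perpField L y p ^ 2 ∂torusMeasure L) +
        a₃ * (∫ p, perpField L y p ^ 3 ∂torusMeasure L) +
        a₄ * (∫ p, perpField L y p ^ 4 ∂torusMeasure L) := by
    intro a₀ a₁ a₂ a₃ a₄
    have j0 : Integrable (fun _ : ℝ × ℝ => a₀) (torusMeasure L) := integrable_const _
    have j1 := j0.fun_add (i1.const_mul a₁)
    have j2 := j1.fun_add (i2.const_mul a₂)
    have j3 := j2.fun_add (i3.const_mul a₃)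
    rw [integral_add j3 (i4.const_mul a₄), integral_add j2 (i3.const_mul a₃),
      integral_add j1 (i2.const_mul a₂), integral_add j0 (i1.const_mul a₁), integral_const,
      torusMeasure_real_univ hL]
    simp only [integral_const_mul, m1, smul_eq_mul]
    ring
  have e2 : wickInt₂ L y = (∫ p, perpField L y p ^ 2 ∂torusMeasure L) - c * L ^ 2 := by
    rw [wickInt₂]
    refine (integral_congr_ae (Eventually.of_forall fun p => ?_)).trans
      ((hint (-c) 0 1 0 0).trans (by ring))
    simp only [wickTwo]; ring
  have e3 : wickInt₃ L y = ∫ p, perpField L y p ^ 3 ∂torusMeasure L := by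
    rw [wickInt₃]
    refine (integral_congr_ae (Eventually.of_forall fun p => ?_)).trans
      ((hint 0 (-3 * c) 0 1 0).trans (by ring))
    simp only [wickThree]; ring
  have e4 : wickInt₄ L y = (∫ p, perpField L y p ^ 4 ∂torusMeasure L) -
      6 * c * (∫ p, perpField L y p ^ 2 ∂torusMeasure L) + 3 * c ^ 2 * L ^ 2 := by
    rw [wickInt₄]
    refine (integral_congr_ae (Eventually.of_forall fun p => ?_)).trans
      ((hint (3 * c ^ 2) 0 (-6 * c) 0 1).trans (by ring))
    simp only [wickFour]; ring
  have eV : ∫ p, ((√ε * t / L + perpField L (√ε • y) p) ^ 4 -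
        6 * ε * renormConst L N * (√ε * t / L + perpField L (√ε • y) p) ^ 2 +
        3 * ε ^ 2 * renormConst L N ^ 2) ∂torusMeasure L =
      ε ^ 2 * (((t / L) ^ 4 - 6 * renormConst L N * (t / L) ^ 2 + 3 * renormConst L N ^ 2) * L ^ 2 +
        (6 * (t / L) ^ 2 - 6 * renormConst L N) * (∫ p, perpField L y p ^ 2 ∂torusMeasure L) +
        4 * (t / L) * (∫ p, perpField L y p ^ 3 ∂torusMeasure L) +
        ∫ p, perpField L y p ^ 4 ∂torusMeasure L) := by
    rw [← one_mul (∫ p, perpField L y p ^ 4 ∂torusMeasure L), ← hint _ (4 * (t / L) ^ 3 -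
      12 * renormConst L N * (t / L)), ← integral_const_mul]
    refine integral_congr_ae (Eventually.of_forall fun p => ?_)
    simp only [hfield]
    rw [mul_div_assoc, ← mul_add, mul_pow, mul_pow, hs, hs4]
    ring
  rw [potential_eq hL, hz, hy, eV, e2, e3, e4, renormConst_eq hL hL', meanInteraction]
  have eq2 : ∑ k : nonzeroModes N, eigenvalue L k.1 * (√ε • y) k ^ 2 =
      ε * ∑ k : nonzeroModes N, eigenvalue L k.1 * y k ^ 2 := by
    rw [Finset.mul_sum]
    refine Finset.sum_congr rfl fun k _ => ?_
    rw [PiLp.smul_apply, smul_eq_mul, mul_pow, hs]; ring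
  rw [eq2, mul_pow, hs]
  field_simp
  ring

theorem exp_le_one_add_abs_mul_exp_abs (u : ℝ) : Real.exp u ≤ 1 + |u| * Real.exp |u| := by
  have h1 : Real.exp u ≤ Real.exp |u| := Real.exp_le_exp.2 (le_abs_self u)
  have h2 : 1 - |u| ≤ Real.exp (-|u|) := by linarith [Real.add_one_le_exp (-|u|)]
  have h3 : Real.exp (-|u|) * Real.exp |u| = 1 := by rw [← Real.exp_add]; simp
  have h4 := mul_le_mul_of_nonneg_right h2 (Real.exp_pos |u|).le
  linarith

theorem abs_meanInteraction_le {L : ℝ} (hL : 0 < L) (Q T t : ℝ) :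
    |meanInteraction L Q T t| ≤
      t ^ 4 / (4 * L ^ 2) + 3 / (2 * L ^ 2) * t ^ 2 * |Q| + |t| / L * |T| := by
  unfold meanInteraction
  refine (abs_add_three _ _ _).trans ?_
  rw [abs_mul (3 / (2 * L ^ 2) * t ^ 2), abs_mul (t / L), abs_div t L, abs_of_pos hL,
    abs_of_nonneg (by positivity : 0 ≤ t ^ 4 / (4 * L ^ 2)),
    abs_of_nonneg (by positivity : 0 ≤ 3 / (2 * L ^ 2) * t ^ 2)]

/-- Between the wells, where `ε t² ≤ L²`, the quartic interaction is dominated by a fraction of the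
quadratic barrier. -/
theorem abs_mul_meanInteraction_le {L : ℝ} (hL : 0 < L) {ε Q T t : ℝ} (hε : 0 < ε) (hε1 : ε ≤ 1)
    (hQ : ε * |Q| ≤ L ^ 2 / 24) (hT : ε * T ^ 2 ≤ L ^ 2) (ht2 : ε * t ^ 2 ≤ L ^ 2) :
    |ε * meanInteraction L Q T t| ≤ 3 / 8 * t ^ 2 + 4 := by
  have hL2 : 0 < L ^ 2 := by positivity
  have hg := abs_meanInteraction_le hL Q T t
  have ha : ε * (t ^ 4 / (4 * L ^ 2)) ≤ t ^ 2 / 4 := by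
    have : ε * (t ^ 4 / (4 * L ^ 2)) = (ε * t ^ 2) * t ^ 2 / (4 * L ^ 2) := by ring
    rw [this, div_le_div_iff₀ (by positivity) (by norm_num)]
    nlinarith [mul_le_mul_of_nonneg_right ht2 (sq_nonneg t)]
  have hb : ε * (3 / (2 * L ^ 2) * t ^ 2 * |Q|) ≤ t ^ 2 / 16 := by
    have : ε * (3 / (2 * L ^ 2) * t ^ 2 * |Q|) = 3 * (ε * |Q|) * t ^ 2 / (2 * L ^ 2) := by ring
    rw [this, div_le_div_iff₀ (by positivity) (by norm_num)]
    nlinarith [mul_le_mul_of_nonneg_right hQ (sq_nonneg t)]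
  have hc : ε * (|t| / L * |T|) ≤ t ^ 2 / 16 + 4 := by
    have hx : ε * |T| ≤ L := by
      refine abs_le_of_sq_le_sq' ?_ hL.le |>.2
      rw [mul_pow, sq_abs]
      nlinarith [sq_nonneg T]
    have : ε * (|t| / L * |T|) = (ε * |T|) / L * |t| := by ring
    rw [this]
    have h1 : (ε * |T|) / L ≤ 1 := (div_le_one hL).2 hx
    have h2 : (ε * |T|) / L * |t| ≤ |t| := mul_le_of_le_one_left (abs_nonneg t) h1
    have h3 := sq_abs t
    nlinarith [sq_nonneg (|t| / 4 - 2)]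
  rw [abs_mul, abs_of_pos hε]
  have := mul_le_mul_of_nonneg_left hg hε.le
  linarith

theorem abs_meanInteraction_le_mul {L : ℝ} (hL : 0 < L) (Q T t : ℝ) :
    |meanInteraction L Q T t| ≤
      (1 / (4 * L ^ 2) + 3 / (2 * L ^ 2) + 1 / L) * (1 + |Q| + |T|) * (1 + t ^ 4) := by
  have hQ0 := abs_nonneg Q
  have hT0 := abs_nonneg T
  set R := 1 + |Q| + |T| with hR
  have hR0 : 0 ≤ R := by positivity
  refine (abs_meanInteraction_le hL Q T t).trans ?_
  have ht4 : 0 ≤ t ^ 4 := by positivity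
  have q2 : t ^ 2 ≤ 1 + t ^ 4 := by nlinarith [sq_nonneg (t ^ 2 - 1)]
  have q1 : |t| ≤ 1 + t ^ 4 := by nlinarith [sq_abs t, sq_nonneg (|t| - 1)]
  have r1 : t ^ 4 / (4 * L ^ 2) ≤ 1 / (4 * L ^ 2) * R * (1 + t ^ 4) := by
    rw [mul_assoc, div_eq_mul_one_div, mul_comm]
    gcongr
    nlinarith
  have r2 : 3 / (2 * L ^ 2) * t ^ 2 * |Q| ≤ 3 / (2 * L ^ 2) * R * (1 + t ^ 4) := by
    rw [mul_assoc, mul_assoc]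
    gcongr 3 / (2 * L ^ 2) * ?_
    nlinarith
  have r3 : |t| / L * |T| ≤ 1 / L * R * (1 + t ^ 4) := by
    rw [div_eq_mul_one_div, mul_comm |t|, mul_assoc, mul_assoc]
    gcongr 1 / L * ?_
    nlinarith
  linarith

theorem exp_meanInteraction_le {L : ℝ} (hL : 0 < L) {ε Q T t : ℝ} (hε : 0 < ε) (hε1 : ε ≤ 1)
    (hQ : ε * |Q| ≤ L ^ 2 / 24) (hT : ε * T ^ 2 ≤ L ^ 2) (ht2 : ε * t ^ 2 ≤ L ^ 2) :
    Real.exp (-(t ^ 2 / 2) + ε * meanInteraction L Q T t) ≤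
      Real.exp (-(1 / 2) * t ^ 2) +
        ε * ((1 / (4 * L ^ 2) + 3 / (2 * L ^ 2) + 1 / L) * (1 + |Q| + |T|) * Real.exp 4) *
          ((1 + t ^ 4) * Real.exp (-(1 / 8) * t ^ 2)) := by
  have hu := abs_mul_meanInteraction_le hL hε hε1 hQ hT ht2
  have hg := abs_meanInteraction_le_mul hL Q T t
  set A := (1 / (4 * L ^ 2) + 3 / (2 * L ^ 2) + 1 / L) * (1 + |Q| + |T|) with hA
  set u := ε * meanInteraction L Q T t with hu'
  have hu2 : |u| ≤ ε * (A * (1 + t ^ 4)) := by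
    rw [hu', abs_mul, abs_of_pos hε]
    exact mul_le_mul_of_nonneg_left hg hε.le
  have hprod : |u| * Real.exp |u| ≤ ε * (A * (1 + t ^ 4)) * Real.exp (3 / 8 * t ^ 2 + 4) :=
    mul_le_mul hu2 (Real.exp_le_exp.2 hu) (Real.exp_pos _).le ((abs_nonneg u).trans hu2)
  have hexp := (exp_le_one_add_abs_mul_exp_abs u).trans (add_le_add_right hprod 1)
  calc Real.exp (-(t ^ 2 / 2) + u) = Real.exp (-(1 / 2) * t ^ 2) * Real.exp u := by
        rw [← Real.exp_add]; ring_nf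
    _ ≤ Real.exp (-(1 / 2) * t ^ 2) *
        (1 + ε * (A * (1 + t ^ 4)) * Real.exp (3 / 8 * t ^ 2 + 4)) :=
        mul_le_mul_of_nonneg_left hexp (Real.exp_pos _).le
    _ = Real.exp (-(1 / 2) * t ^ 2) + ε * (A * (1 + t ^ 4)) *
        (Real.exp (-(1 / 2) * t ^ 2) * Real.exp (3 / 8 * t ^ 2 + 4)) := by ring
    _ = _ := by
        rw [← Real.exp_add, show -(1 / 2) * t ^ 2 + (3 / 8 * t ^ 2 + 4) =
          4 + -(1 / 8) * t ^ 2 by ring, Real.exp_add]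
        ring

/-- The partition function of the mean mode is that of a standard Gaussian up to an error of
order `ε`. -/
theorem exists_lintegral_exp_meanInteraction_le {L : ℝ} (hL : 0 < L) :
    ∃ K : ℝ, 0 ≤ K ∧ ∀ ε Q T : ℝ, 0 < ε → ε ≤ 1 → ε * |Q| ≤ L ^ 2 / 24 → ε * T ^ 2 ≤ L ^ 2 →
      ∀ s : Set ℝ, (∀ t ∈ s, ε * t ^ 2 ≤ L ^ 2) → MeasurableSet s →
      ∫⁻ t in s, ENNReal.ofReal (Real.exp (-(t ^ 2 / 2) + ε * meanInteraction L Q T t)) ≤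
        ENNReal.ofReal (√(2 * Real.pi) * (1 + ε * (K * (1 + |Q| + |T|)))) := by
  set K₀ : ℝ := 1 / (4 * L ^ 2) + 3 / (2 * L ^ 2) + 1 / L with hK₀
  have hK₀0 : 0 ≤ K₀ := by positivity
  have hint8 : Integrable (fun t : ℝ => (1 + t ^ 4) * Real.exp (-(1 / 8) * t ^ 2)) := by
    have h1 := integrable_exp_neg_mul_sq (b := 1 / 8) (by norm_num)
    have h2 := integrable_rpow_mul_exp_neg_mul_sq (b := 1 / 8) (by norm_num) (s := 4) (by norm_num)
    refine (h1.add h2).congr (Eventually.of_forall fun t => ?_)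
    have : t ^ (4 : ℝ) = t ^ 4 := by exact_mod_cast Real.rpow_natCast t 4
    simp only [Pi.add_apply, this]
    ring
  have hint2 := integrable_exp_neg_mul_sq (b := 1 / 2) (by norm_num)
  set M := ∫ t : ℝ, (1 + t ^ 4) * Real.exp (-(1 / 8) * t ^ 2) with hM
  have hM0 : 0 ≤ M := integral_nonneg fun t => by positivity
  have h2π : 0 < √(2 * Real.pi) := by have := Real.pi_pos; positivity
  refine ⟨K₀ * Real.exp 4 * M / √(2 * Real.pi), by positivity, ?_⟩
  intro ε Q T hε hε1 hQ hT s hs hsm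
  set R := 1 + |Q| + |T| with hR
  have hQ0 := abs_nonneg Q
  have hT0 := abs_nonneg T
  have hR0 : 0 ≤ R := by positivity
  have hA : 0 ≤ ε * (K₀ * R * Real.exp 4) := by positivity
  calc _ ≤ ∫⁻ t in s, ENNReal.ofReal (Real.exp (-(1 / 2) * t ^ 2) +
        ε * (K₀ * R * Real.exp 4) * ((1 + t ^ 4) * Real.exp (-(1 / 8) * t ^ 2))) :=
        setLIntegral_mono' hsm fun t ht => ENNReal.ofReal_le_ofReal
          (exp_meanInteraction_le hL hε hε1 hQ hT (hs t ht))
    _ ≤ ∫⁻ t, ENNReal.ofReal (Real.exp (-(1 / 2) * t ^ 2) +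
        ε * (K₀ * R * Real.exp 4) * ((1 + t ^ 4) * Real.exp (-(1 / 8) * t ^ 2))) :=
        setLIntegral_le_lintegral _ _
    _ = ENNReal.ofReal (∫ t, (Real.exp (-(1 / 2) * t ^ 2) +
        ε * (K₀ * R * Real.exp 4) * ((1 + t ^ 4) * Real.exp (-(1 / 8) * t ^ 2)))) :=
        (ofReal_integral_eq_lintegral_ofReal (hint2.add (hint8.const_mul _))
          (Eventually.of_forall fun t => add_nonneg (Real.exp_pos _).le
            (mul_nonneg hA (by positivity)))).symm
    _ = _ := by
        rw [integral_add hint2 (hint8.const_mul _), integral_const_mul, ← hM,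
          integral_gaussian]
        congr 1
        rw [show Real.pi / (1 / 2) = 2 * Real.pi by ring]
        field_simp

/-- One plus the sum of squares of the integrated Wick powers, which controls all error terms. -/
noncomputable def wickError (L : ℝ) {N : ℕ} (y : PerpSpace N) : ℝ :=
  1 + wickInt₂ L y ^ 2 + wickInt₃ L y ^ 2 + wickInt₄ L y ^ 2

/-- Pointwise bound on the effective density at the transversal point `y`: the inverse of the
partition function of the mean mode is `exp (-E) / √(2π)` up to a relative error of order
`ε wickError`. In the application `E` is the quadratic form `½ ∑ λ_k y_k²`. -/
theorem exists_le_inv_partition {L : ℝ} (hL : 0 < L) :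
    ∃ K : ℝ, 0 ≤ K ∧ ∀ ε : ℝ, 0 < ε → ε ≤ 1 → ∀ (N : ℕ) (y : PerpSpace N) (s : Set ℝ),
      (∀ t ∈ s, ε * t ^ 2 ≤ L ^ 2) → MeasurableSet s → ∀ E : ℝ,
      ENNReal.ofReal ((√(2 * Real.pi))⁻¹ * Real.exp (-E) * (1 - ε * (K * wickError L y))) ≤
        (∫⁻ t in s, ENNReal.ofReal (Real.exp (-(t ^ 2 / 2) + E +
          ε * (meanInteraction L (wickInt₂ L y - 1) (wickInt₃ L y) t +
            (wickInt₄ L y - 6 / L ^ 2 * wickInt₂ L y + 3 / L ^ 2) / 4))))⁻¹ := by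
  obtain ⟨K, hK, h⟩ := exists_lintegral_exp_meanInteraction_le hL
  refine ⟨(1 + 9 / L ^ 2) / 4 + 4 * K + 48 / L ^ 2, by positivity, ?_⟩
  intro ε hε hε1 N y s hs hsm E
  set q := wickInt₂ L y with hq
  set T := wickInt₃ L y with hT
  set W := (wickInt₄ L y - 6 / L ^ 2 * q + 3 / L ^ 2) / 4 with hW
  set S := wickError L y with hS
  have hS' : S = 1 + q ^ 2 + T ^ 2 + wickInt₄ L y ^ 2 := rfl
  have hS1 : 1 ≤ S := by rw [hS']; nlinarith [sq_nonneg q, sq_nonneg T, sq_nonneg (wickInt₄ L y)]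
  have hqS : |q| ≤ S := by
    rw [hS']; nlinarith [sq_abs q, sq_nonneg (|q| - 1), sq_nonneg T, sq_nonneg (wickInt₄ L y)]
  have hTS : |T| ≤ S := by
    rw [hS']; nlinarith [sq_abs T, sq_nonneg (|T| - 1), sq_nonneg q, sq_nonneg (wickInt₄ L y)]
  have h4S : |wickInt₄ L y| ≤ S := by
    rw [hS']; nlinarith [sq_abs (wickInt₄ L y), sq_nonneg (|wickInt₄ L y| - 1), sq_nonneg q,
      sq_nonneg T]
  have hL2 : 0 < L ^ 2 := by positivity
  have h2π : 0 < √(2 * Real.pi) := by have := Real.pi_pos; positivity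
  by_cases hG : ε * S ≤ L ^ 2 / 48
  swap
  · -- Where the error is not small the left-hand side is negative.
    push Not at hG
    have h1 : 1 ≤ 48 / L ^ 2 * (ε * S) := by
      rw [div_mul_eq_mul_div, le_div_iff₀ hL2]; linarith
    have h2 : 1 - ε * (((1 + 9 / L ^ 2) / 4 + 4 * K + 48 / L ^ 2) * S) ≤ 0 := by
      have : 0 ≤ ((1 + 9 / L ^ 2) / 4 + 4 * K) * (ε * S) := by positivity
      linarith
    rw [ENNReal.ofReal_of_nonpos (mul_nonpos_of_nonneg_of_nonpos (by positivity) h2)]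
    exact zero_le
  have hQ1 : |q - 1| ≤ 2 * S := by
    have := abs_sub q 1
    rw [abs_one] at this
    linarith
  have hQ : ε * |q - 1| ≤ L ^ 2 / 24 := by nlinarith
  have hT2 : ε * T ^ 2 ≤ L ^ 2 := by
    have : T ^ 2 ≤ S := by rw [hS']; nlinarith [sq_nonneg q, sq_nonneg (wickInt₄ L y)]
    nlinarith
  have hmain := h ε (q - 1) T hε hε1 hQ hT2 s hs hsm
  have hfac : ∫⁻ t in s, ENNReal.ofReal (Real.exp (-(t ^ 2 / 2) + E +
      ε * (meanInteraction L (q - 1) T t + W))) = ENNReal.ofReal (Real.exp (E + ε * W)) *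
      ∫⁻ t in s, ENNReal.ofReal (Real.exp (-(t ^ 2 / 2) + ε * meanInteraction L (q - 1) T t)) := by
    rw [← lintegral_const_mul' _ _ ENNReal.ofReal_ne_top]
    refine lintegral_congr fun t => ?_
    rw [← ENNReal.ofReal_mul (Real.exp_pos _).le, ← Real.exp_add]
    ring_nf
  rw [hfac]
  set x := ε * (K * (1 + |q - 1| + |T|)) with hx
  have hx0 : 0 ≤ x := by positivity
  have hden : 0 < √(2 * Real.pi) * (1 + x) := by positivity
  refine le_trans ?_ (ENNReal.inv_le_inv.2 (mul_le_mul_right hmain _))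
  rw [← ENNReal.ofReal_mul (Real.exp_pos _).le, ← ENNReal.ofReal_inv_of_pos (by positivity)]
  refine ENNReal.ofReal_le_ofReal ?_
  have hexp : (Real.exp (E + ε * W) * (√(2 * Real.pi) * (1 + x)))⁻¹ =
      (√(2 * Real.pi))⁻¹ * Real.exp (-E) * (Real.exp (-(ε * W)) / (1 + x)) := by
    rw [Real.exp_add, Real.exp_neg, Real.exp_neg]
    field_simp
  rw [hexp]
  refine mul_le_mul_of_nonneg_left ?_ (by positivity)
  -- Since `1 + x ≤ exp x`, the quotient is at least `exp (-(ε W + x)) ≥ 1 - ε W - x`.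
  have hq1 : 1 - ε * W - x ≤ Real.exp (-(ε * W)) / (1 + x) := by
    rw [le_div_iff₀ (by positivity)]
    calc (1 - ε * W - x) * (1 + x) ≤ Real.exp (-(ε * W) - x) * (1 + x) := by
          gcongr
          linarith [Real.add_one_le_exp (-(ε * W) - x)]
      _ ≤ Real.exp (-(ε * W) - x) * Real.exp x := by
          gcongr
          linarith [Real.add_one_le_exp x]
      _ = _ := by rw [← Real.exp_add]; ring_nf
  refine le_trans ?_ hq1
  have hWS : W ≤ (1 + 9 / L ^ 2) / 4 * S := by
    have h1 := le_abs_self (wickInt₄ L y)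
    have h2 := neg_abs_le q
    have h3 : 6 / L ^ 2 * (-q) ≤ 6 / L ^ 2 * S := by gcongr; linarith
    have h4 : 3 / L ^ 2 * 1 ≤ 3 / L ^ 2 * S := by gcongr
    have h5 : (1 + 9 / L ^ 2) / 4 * S = (S + 6 / L ^ 2 * S + 3 / L ^ 2 * S) / 4 := by ring
    rw [hW, h5]
    linarith
  have hxS : x ≤ ε * (4 * K * S) := by
    rw [hx, show 4 * K * S = K * (4 * S) by ring]
    gcongr
    linarith
  have hWε := mul_le_mul_of_nonneg_left hWS hε.le
  have : 0 ≤ 48 / L ^ 2 * (ε * S) := by positivity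
  linarith

/-! ### Slicing the state space along the mean mode -/

/-- The point of the state space with transversal part `w` and mean coordinate `s`. -/
noncomputable def glue {N : ℕ} (x : PerpSpace N × ℝ) : Space N :=
  WithLp.toLp 2 fun k =>
    if h : k.1 = 0 then x.2 else x.1 ⟨k.1, Finset.mem_erase.2 ⟨h, k.2⟩⟩

@[simp]
theorem zeroCoord_glue {N : ℕ} (x : PerpSpace N × ℝ) : zeroCoord (glue x) = x.2 := by
  simp [zeroCoord, glue]

@[simp]
theorem perpPart_glue {N : ℕ} (x : PerpSpace N × ℝ) : perpPart (glue x) = x.1 := by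
  ext k
  simp [perpPart, glue, ne_zero_of_nonzeroModes k]

theorem glue_perpPart_zeroCoord {N : ℕ} (z : Space N) : glue (perpPart z, zeroCoord z) = z := by
  ext k
  by_cases h : k.1 = 0
  · have : k = ⟨0, zero_mem_modes N⟩ := Subtype.ext h
    subst this
    simp [glue, zeroCoord]
  · simp [glue, perpPart, h]

/-- The orthogonal splitting of the state space into transversal part and mean coordinate. -/
noncomputable def splitIsometry (N : ℕ) : Space N ≃ₗᵢ[ℝ] WithLp 2 (PerpSpace N × ℝ) where
  toFun z := WithLp.toLp 2 (perpPart z, zeroCoord z)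
  invFun x := glue x.ofLp
  left_inv z := glue_perpPart_zeroCoord z
  right_inv x := by
    apply WithLp.ofLp_injective
    simp
    rfl
  map_add' z z' := by
    apply WithLp.ofLp_injective
    ext <;> simp [perpPart, zeroCoord]
  map_smul' c z := by
    apply WithLp.ofLp_injective
    ext <;> simp [perpPart, zeroCoord]
  norm_map' z := by
    rw [← sq_eq_sq₀ (norm_nonneg _) (norm_nonneg _)]
    change ‖WithLp.toLp 2 (perpPart z, zeroCoord z)‖ ^ 2 = ‖z‖ ^ 2
    rw [WithLp.prod_norm_sq_eq_of_L2, EuclideanSpace.real_norm_sq_eq,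
      EuclideanSpace.real_norm_sq_eq, sum_modes_eq, add_comm]
    simp [perpPart, zeroCoord]

/-- The splitting of the state space, as a continuous linear equivalence. -/
noncomputable def splitEquiv (N : ℕ) : Space N ≃L[ℝ] PerpSpace N × ℝ :=
  (splitIsometry N).toContinuousLinearEquiv.trans
    (WithLp.prodContinuousLinearEquiv 2 ℝ (PerpSpace N) ℝ)

@[fun_prop]
theorem continuous_glue (N : ℕ) : Continuous (glue (N := N)) := (splitEquiv N).symm.continuous

@[fun_prop]
theorem continuous_perpPart (N : ℕ) : Continuous (perpPart (N := N)) :=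
  continuous_fst.comp (splitEquiv N).continuous

@[fun_prop]
theorem continuous_zeroCoord (N : ℕ) : Continuous (zeroCoord (N := N)) :=
  continuous_snd.comp (splitEquiv N).continuous

theorem measurableEmbedding_glue (N : ℕ) : MeasurableEmbedding (glue (N := N)) :=
  (splitEquiv N).symm.toHomeomorph.measurableEmbedding

theorem measurePreserving_glue (N : ℕ) : MeasurePreserving (glue (N := N)) := by
  have h1 := (splitIsometry N).symm.measurePreserving
  have h2 := WithLp.volume_preserving_toLp (PerpSpace N) ℝ
  exact h1.comp h2

theorem integrableOn_comp_glue {N : ℕ} {f : Space N → ℝ} (hf : LocallyIntegrable f)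
    {K : Set (PerpSpace N)} (hK : IsCompact K) {S : Set ℝ} (hS : IsCompact S) :
    IntegrableOn (fun x => f (glue x)) (K ×ˢ S) := by
  have hC : IsCompact (glue '' (K ×ˢ S)) := (hK.prod hS).image (continuous_glue N)
  have h := hf.integrableOn_isCompact hC
  rw [← (measurePreserving_glue N).integrableOn_comp_preimage (measurableEmbedding_glue N),
    preimage_image_eq _ (measurableEmbedding_glue N).injective] at h
  exact h

/-- Almost every line parallel to the mean mode sees a locally integrable function. -/
theorem ae_integrableOn_slice {N : ℕ} {f : Space N → ℝ} (hf : LocallyIntegrable f) {S : Set ℝ}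
    (hS : IsCompact S) : ∀ᵐ w, IntegrableOn (fun s => f (glue (w, s))) S := by
  have h : ∀ m : ℕ, ∀ᵐ w ∂volume.restrict (Metric.closedBall (0 : PerpSpace N) m),
      IntegrableOn (fun s => f (glue (w, s))) S := by
    intro m
    have := integrableOn_comp_glue hf (isCompact_closedBall (0 : PerpSpace N) m) hS
    rw [IntegrableOn, Measure.volume_eq_prod, ← Measure.prod_restrict] at this
    exact this.prod_right_ae
  have := (ae_restrict_iUnion_iff (μ := (volume : Measure (PerpSpace N)))
    (fun m : ℕ => Metric.closedBall (0 : PerpSpace N) m) _).2 h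
  rwa [Metric.iUnion_closedBall_nat, Measure.restrict_univ] at this

theorem fderiv_mul_split {N : ℕ} {η : ℝ → ℝ} {χ : PerpSpace N → ℝ} (hη : ContDiff ℝ (⊤ : ℕ∞) η)
    (hχ : ContDiff ℝ (⊤ : ℕ∞) χ) :
    ContDiff ℝ (⊤ : ℕ∞) (fun z : Space N => η (zeroCoord z) * χ (perpPart z)) ∧
    ∀ z : Space N, fderiv ℝ (fun z : Space N => η (zeroCoord z) * χ (perpPart z)) z
      (EuclideanSpace.single ⟨0, zero_mem_modes N⟩ 1) =
      deriv η (zeroCoord z) * χ (perpPart z) := by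
  have h1 : ContDiff ℝ (⊤ : ℕ∞) (zeroCoord (N := N)) :=
    (contDiff_snd.comp (splitEquiv N).contDiff :)
  have h2 : ContDiff ℝ (⊤ : ℕ∞) (perpPart (N := N)) :=
    (contDiff_fst.comp (splitEquiv N).contDiff :)
  have h3 := (hη.comp h1).mul (hχ.comp h2)
  refine ⟨h3, fun z => ?_⟩
  have hd : DifferentiableAt ℝ (fun z : Space N => η (zeroCoord z) * χ (perpPart z)) z :=
    (h3.differentiable (by simp)).differentiableAt
  rw [← hd.lineDeriv_eq_fderiv, lineDeriv]
  have e1 : ∀ t : ℝ, zeroCoord (z + t • EuclideanSpace.single ⟨0, zero_mem_modes N⟩ (1 : ℝ)) =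
      zeroCoord z + t := by
    intro t; simp [zeroCoord]
  have e2 : ∀ t : ℝ, perpPart (z + t • EuclideanSpace.single ⟨0, zero_mem_modes N⟩ (1 : ℝ)) =
      perpPart z := by
    intro t
    ext k
    simp [perpPart, ne_zero_of_nonzeroModes k]
  simp only [e1, e2]
  rw [deriv_mul_const_field, deriv_comp_const_add, add_zero]

/-- Integration by parts along almost every line parallel to the mean mode, for a function with a
weak gradient. -/
theorem ae_slice_integral_eq {N : ℕ} {h : Space N → ℝ} {G : Space N → Space N}
    (hG : HasWeakGradient h G) {η : ℝ → ℝ} (hη : ContDiff ℝ (⊤ : ℕ∞) η)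
    (hηc : HasCompactSupport η) :
    ∀ᵐ w, ∫ s, (h (glue (w, s)) * deriv η s + zeroCoord (G (glue (w, s))) * η s) = 0 := by
  obtain ⟨hh, hGi, hweak⟩ := hG
  have hη' : Continuous (deriv η) := hη.continuous_deriv (by simp)
  set H : Space N → ℝ := fun z => h z * deriv η (zeroCoord z) + zeroCoord (G z) * η (zeroCoord z)
    with hH
  have hG0 : LocallyIntegrable (fun z => zeroCoord (G z)) := fun z => by
    obtain ⟨u, hu, hi⟩ := hGi z
    exact ⟨u, hu, (EuclideanSpace.proj (𝕜 := ℝ)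
      (⟨0, zero_mem_modes N⟩ : modes N)).integrable_comp hi⟩
  have hHl : LocallyIntegrable H := by
    refine LocallyIntegrable.add ?_ ?_
    · exact hh.mul_continuous (hη'.comp (continuous_zeroCoord N))
    · exact hG0.mul_continuous (hη.continuous.comp (continuous_zeroCoord N))
  have hH0 : ∀ x : PerpSpace N × ℝ, x.2 ∉ tsupport η → H (glue x) = 0 := by
    intro x hx
    have e1 : η x.2 = 0 := image_eq_zero_of_notMem_tsupport hx
    have e2 : deriv η x.2 = 0 :=
      image_eq_zero_of_notMem_tsupport fun h' => hx (tsupport_deriv_subset h')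
    simp [hH, e1, e2]
  have hint : ∀ K : Set (PerpSpace N), IsCompact K →
      IntegrableOn (fun x => H (glue x)) (K ×ˢ univ) := by
    intro K hK
    refine (integrableOn_comp_glue hHl hK hηc).of_forall_sdiff_eq_zero
      (hK.measurableSet.prod MeasurableSet.univ) fun x hx => hH0 x fun h' => hx.2 ⟨hx.1.1, h'⟩
  have hslice : LocallyIntegrable fun w : PerpSpace N => ∫ s, H (glue (w, s)) := by
    rw [locallyIntegrable_iff]
    intro K hK
    have := hint K hK
    rw [IntegrableOn, Measure.volume_eq_prod, ← Measure.prod_restrict, Measure.restrict_univ] at this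
    exact this.integral_prod_left
  have key := ae_eq_zero_of_integral_contDiff_smul_eq_zero hslice fun χ hχ hχc => ?_
  · filter_upwards [key] with w hw
    simpa [hH] using hw
  · obtain ⟨hψ, hψd⟩ := fderiv_mul_split (N := N) hη hχ
    have hψc : HasCompactSupport fun z : Space N => η (zeroCoord z) * χ (perpPart z) := by
      refine HasCompactSupport.intro ((hχc.isCompact.prod hηc.isCompact).image (continuous_glue N))
        fun z hz => ?_
      by_contra h0
      apply hz
      refine ⟨(perpPart z, zeroCoord z), ⟨?_, ?_⟩, glue_perpPart_zeroCoord z⟩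
      · exact subset_tsupport _ (right_ne_zero_of_mul h0)
      · exact subset_tsupport _ (left_ne_zero_of_mul h0)
    have hw := hweak _ hψ hψc (EuclideanSpace.single ⟨0, zero_mem_modes N⟩ 1)
    have hinner : ∀ z, inner ℝ (G z) (EuclideanSpace.single ⟨0, zero_mem_modes N⟩ 1) =
        zeroCoord (G z) := by
      intro z
      rw [EuclideanSpace.inner_single_right]
      simp [zeroCoord]
    simp only [hψd, hinner] at hw
    have hχi : Integrable fun x : PerpSpace N × ℝ => χ x.1 * H (glue x) := by
      have h1 := (integrableOn_comp_glue hHl hχc.isCompact hηc.isCompact).continuousOn_mul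
        (hχ.continuous.comp continuous_fst).continuousOn (hχc.isCompact.prod hηc.isCompact)
      rw [← integrableOn_univ]
      refine h1.of_forall_sdiff_eq_zero MeasurableSet.univ fun x hx => ?_
      by_cases hx2 : x.2 ∈ tsupport η
      · have : χ x.1 = 0 := image_eq_zero_of_notMem_tsupport fun h' => hx.2 ⟨h', hx2⟩
        simp [this]
      · rw [hH0 x hx2, mul_zero]
    have i1 : Integrable fun z => h z * (deriv η (zeroCoord z) * χ (perpPart z)) := by
      have hc : HasCompactSupport fun z : Space N => deriv η (zeroCoord z) * χ (perpPart z) := by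
        have := hψc.fderiv_apply (𝕜 := ℝ) (EuclideanSpace.single ⟨0, zero_mem_modes N⟩ 1)
        simpa only [hψd] using this
      have := hh.integrable_smul_right_of_hasCompactSupport
        (by have := hχ.continuous; fun_prop :
          Continuous fun z : Space N => deriv η (zeroCoord z) * χ (perpPart z)) hc
      simpa using this
    have i2 : Integrable fun z => zeroCoord (G z) * (η (zeroCoord z) * χ (perpPart z)) := by
      have := hG0.integrable_smul_right_of_hasCompactSupport hψ.continuous hψc
      simpa using this
    calc ∫ w, χ w • ∫ s, H (glue (w, s)) = ∫ w, ∫ s, χ w * H (glue (w, s)) := by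
          simp only [smul_eq_mul, integral_const_mul]
      _ = ∫ x : PerpSpace N × ℝ, χ x.1 * H (glue x) := by
          rw [Measure.volume_eq_prod, integral_prod _ hχi]
      _ = ∫ z, χ (perpPart z) * H z := by
          rw [← (measurePreserving_glue N).integral_comp (measurableEmbedding_glue N)]
          simp
      _ = ∫ z, (h z * (deriv η (zeroCoord z) * χ (perpPart z)) +
            zeroCoord (G z) * (η (zeroCoord z) * χ (perpPart z))) := by
          congr 1; ext z; simp only [hH]; ring
      _ = 0 := by
          rw [integral_add i1 i2, hw]; ring

/-! ### Reduction of the capacity to one-dimensional problems -/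

/-- A smooth cutoff on the line which equals one on `[-a, a]` and vanishes off
`[-(a + e), a + e]`. -/
theorem exists_cutoff {a e : ℝ} (ha : 0 < a) (he : 0 < e) :
    ∃ η : ℝ → ℝ, ContDiff ℝ (⊤ : ℕ∞) η ∧ HasCompactSupport η ∧ (∀ s, |s| ≤ a → η s = 1) ∧
      (∀ s, a + e ≤ |s| → η s = 0) ∧ (∀ s, |η s| ≤ 1) ∧
      ∀ s, deriv η s ≠ 0 → a ≤ |s| ∧ |s| ≤ a + e := by
  let f : ContDiffBump (0 : ℝ) := ⟨a, a + e, ha, by linarith⟩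
  have h1 : ∀ s, |s| ≤ a → f s = 1 := fun s hs =>
    f.one_of_mem_closedBall (by simpa using hs)
  have h0 : ∀ s, a + e ≤ |s| → f s = 0 := fun s hs =>
    f.zero_of_le_dist (by simpa using hs)
  refine ⟨f, f.contDiff, f.hasCompactSupport, h1, h0, fun s => ?_, fun s hs => ?_⟩
  · rw [abs_of_nonneg f.nonneg]; exact f.le_one
  · constructor
    · by_contra! h
      apply hs
      have : (f : ℝ → ℝ) =ᶠ[𝓝 s] fun _ => 1 := by
        filter_upwards [(continuous_abs.isOpen_preimage _ isOpen_Iio).mem_nhds h] with t ht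
        exact h1 t (le_of_lt ht)
      rw [this.deriv_eq, deriv_const]
    · by_contra! h
      apply hs
      have : (f : ℝ → ℝ) =ᶠ[𝓝 s] fun _ => 0 := by
        filter_upwards [(continuous_abs.isOpen_preimage _ isOpen_Ioi).mem_nhds h] with t ht
        exact h0 t (le_of_lt ht)
      rw [this.deriv_eq, deriv_const]

/-- The fundamental theorem of calculus for a function which is one to the left and zero to the
right of `[-a, a]`, with the derivative `g` understood weakly. Only the behaviour of `h` on the two
adjacent intervals enters, so no regularity of `h` is needed. -/
theorem integral_weakDeriv_eq_neg_one {a a' : ℝ} (ha : 0 < a) (haa' : a < a') {h g : ℝ → ℝ}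
    (hg : IntegrableOn g (Icc (-a') a'))
    (hh : IntegrableOn h (Icc (-a') a'))
    (h1 : ∀ᵐ s, s ∈ Icc (-a') (-a) → h s = 1) (h0 : ∀ᵐ s, s ∈ Icc a a' → h s = 0)
    {η : ℕ → ℝ → ℝ} (hη : ∀ n, ContDiff ℝ (⊤ : ℕ∞) (η n) ∧ HasCompactSupport (η n) ∧
      (∀ s, |s| ≤ a → η n s = 1) ∧ (∀ s, a + (a' - a) / (n + 1) ≤ |s| → η n s = 0) ∧
      (∀ s, |η n s| ≤ 1) ∧ ∀ s, deriv (η n) s ≠ 0 → a ≤ |s| ∧ |s| ≤ a + (a' - a) / (n + 1))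
    (hweak : ∀ n, ∫ s, (h s * deriv (η n) s + g s * η n s) = 0) :
    ∫ s in Icc (-a) a, g s = -1 := by
  have he : ∀ n : ℕ, (a' - a) / ((n : ℝ) + 1) ≤ a' - a := fun n =>
    div_le_self (by linarith) (by linarith [(Nat.cast_nonneg n : (0 : ℝ) ≤ n)])
  have hout : ∀ (n : ℕ) s, s ∉ Icc (-a') a' → η n s = 0 := by
    intro n s hs
    refine (hη n).2.2.2.1 s ?_
    rw [mem_Icc, ← abs_le] at hs
    push Not at hs
    linarith [he n]
  have hout' : ∀ (n : ℕ) s, s ∉ Icc (-a') a' → deriv (η n) s = 0 := by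
    intro n s hs
    by_contra h'
    have := ((hη n).2.2.2.2.2 s h').2
    rw [mem_Icc, ← abs_le] at hs
    push Not at hs
    linarith [he n]
  have hcont : ∀ n, Continuous (deriv (η n)) := fun n => (hη n).1.continuous_deriv (by simp)
  have hval : ∀ n, ∫ s, g s * η n s = -1 := by
    intro n
    have i1 : Integrable fun s => h s * deriv (η n) s := by
      rw [← integrableOn_univ]
      exact (hh.mul_continuousOn (hcont n).continuousOn isCompact_Icc).of_forall_sdiff_eq_zero
        MeasurableSet.univ fun s hs => by rw [hout' n s hs.2, mul_zero]
    have i2 : Integrable fun s => g s * η n s := by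
      rw [← integrableOn_univ]
      exact (hg.mul_continuousOn (hη n).1.continuous.continuousOn
        isCompact_Icc).of_forall_sdiff_eq_zero
        MeasurableSet.univ fun s hs => by rw [hout n s hs.2, mul_zero]
    have e1 : ∫ s, h s * deriv (η n) s = 1 := by
      have : (fun s => h s * deriv (η n) s) =ᵐ[volume]
          (Iic (0 : ℝ)).indicator fun s => deriv (η n) s := by
        filter_upwards [h1, h0] with s hs1 hs0
        by_cases hd : deriv (η n) s = 0
        · simp [indicator, hd]
        · obtain ⟨l1, l2⟩ := (hη n).2.2.2.2.2 s hd
          have l3 := he n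
          by_cases hs : s ≤ 0
          · rw [abs_of_nonpos hs] at l1 l2
            rw [indicator_of_mem (by exact hs), hs1 ⟨by linarith, by linarith⟩, one_mul]
          · push Not at hs
            rw [abs_of_pos hs] at l1 l2
            rw [indicator_of_notMem (by simpa using hs), hs0 ⟨by linarith, by linarith⟩, zero_mul]
      rw [integral_congr_ae this, integral_indicator measurableSet_Iic,
        HasCompactSupport.integral_Iic_deriv_eq ((hη n).1.of_le (by exact_mod_cast le_top))
          (hη n).2.1 0,
        (hη n).2.2.1 0 (by simpa using ha.le)]
    have := hweak n
    rw [integral_add i1 i2, e1] at this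
    linarith
  have hlim : Tendsto (fun n => ∫ s, g s * η n s) atTop
      (𝓝 (∫ s, (Icc (-a) a).indicator g s)) := by
    refine tendsto_integral_of_dominated_convergence ((Icc (-a') a').indicator fun s => ‖g s‖)
      (fun n => ?_) ?_ (fun n => Eventually.of_forall fun s => ?_) (Eventually.of_forall fun s => ?_)
    · have : (fun s => g s * η n s) = fun s => (Icc (-a') a').indicator g s * η n s := by
        ext s
        by_cases hs : s ∈ Icc (-a') a'
        · rw [indicator_of_mem hs]
        · rw [hout n s hs, mul_zero, mul_zero]
      rw [this]
      exact ((integrable_indicator_iff measurableSet_Icc).2 hg).aestronglyMeasurable.mul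
        (hη n).1.continuous.aestronglyMeasurable
    · exact (integrable_indicator_iff measurableSet_Icc).2 hg.norm
    · by_cases hs : s ∈ Icc (-a') a'
      · rw [indicator_of_mem hs, norm_mul]
        exact mul_le_of_le_one_right (norm_nonneg _) ((hη n).2.2.2.2.1 s)
      · rw [hout n s hs, indicator_of_notMem hs]; simp
    · by_cases hs : s ∈ Icc (-a) a
      · rw [indicator_of_mem hs]
        refine tendsto_const_nhds.congr fun n => ?_
        rw [(hη n).2.2.1 s (abs_le.2 hs), mul_one]
      · rw [indicator_of_notMem hs]
        rw [mem_Icc, ← abs_le] at hs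
        push Not at hs
        have ht : Tendsto (fun n : ℕ => a + (a' - a) / ((n : ℝ) + 1)) atTop (𝓝 (a + 0)) :=
          tendsto_const_nhds.add (by
            simpa [div_eq_mul_inv] using
              (tendsto_one_div_add_atTop_nhds_zero_nat (𝕜 := ℝ)).const_mul (a' - a))
        rw [add_zero] at ht
        refine tendsto_const_nhds.congr' ?_
        filter_upwards [ht.eventually_lt_const hs] with n hn
        rw [(hη n).2.2.2.1 s hn.le, mul_zero]
  simp only [hval] at hlim
  rw [← integral_indicator measurableSet_Icc]
  exact (tendsto_nhds_unique hlim tendsto_const_nhds)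

/-- The one-dimensional capacity between two points is the inverse of the integral of the inverse
weight; here the lower bound, from the Cauchy-Schwarz inequality. -/
theorem inv_lintegral_exp_le {a : ℝ} {g : ℝ → ℝ} (hgi : ∫ s in Icc (-a) a, g s = -1)
    {v : ℝ → ℝ} (hv : Measurable v) {k : ℝ → ℝ} (hk : ∀ s, g s ^ 2 ≤ k s) :
    (∫⁻ s in Ioo (-a) a, ENNReal.ofReal (Real.exp (v s)))⁻¹ ≤
      ∫⁻ s in Ioo (-a) a, ENNReal.ofReal (k s * Real.exp (-v s)) := by
  set μ := volume.restrict (Ioo (-a) a) with hμ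
  rw [integral_Icc_eq_integral_Ioo] at hgi
  have hgm : AEStronglyMeasurable g μ := by
    by_contra hc
    rw [integral_undef fun h => hc h.1] at hgi
    norm_num at hgi
  have h1 : (1 : ℝ≥0∞) ≤ ∫⁻ s, ENNReal.ofReal (|g s| * Real.exp (-v s / 2)) *
      ENNReal.ofReal (Real.exp (v s / 2)) ∂μ := by
    calc (1 : ℝ≥0∞) = ‖∫ s, g s ∂μ‖ₑ := by rw [hgi]; simp
      _ ≤ ∫⁻ s, ‖g s‖ₑ ∂μ := enorm_integral_le_lintegral_enorm _
      _ = _ := by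
        refine lintegral_congr fun s => ?_
        rw [← ENNReal.ofReal_mul (by positivity), mul_assoc, ← Real.exp_add, Real.enorm_eq_ofReal_abs]
        ring_nf
        simp
  have hm1 : AEMeasurable (fun s => ENNReal.ofReal (|g s| * Real.exp (-v s / 2))) μ := by
    have := hgm.aemeasurable
    fun_prop
  have hm2 : AEMeasurable (fun s => ENNReal.ofReal (Real.exp (v s / 2))) μ := by fun_prop
  have h2 := ENNReal.lintegral_mul_le_Lp_mul_Lq μ Real.HolderConjugate.two_two hm1 hm2
  have e1 : ∀ s, ENNReal.ofReal (|g s| * Real.exp (-v s / 2)) ^ (2 : ℝ) =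
      ENNReal.ofReal (g s ^ 2 * Real.exp (-v s)) := by
    intro s
    rw [ENNReal.ofReal_rpow_of_nonneg (by positivity) (by norm_num)]
    congr 1
    rw [show (2 : ℝ) = (2 : ℕ) by norm_num, Real.rpow_natCast, mul_pow, sq_abs, ← Real.exp_nat_mul]
    congr 2
    push_cast
    ring
  have e2 : ∀ s, ENNReal.ofReal (Real.exp (v s / 2)) ^ (2 : ℝ) =
      ENNReal.ofReal (Real.exp (v s)) := by
    intro s
    rw [ENNReal.ofReal_rpow_of_nonneg (by positivity) (by norm_num)]
    congr 1
    rw [show (2 : ℝ) = (2 : ℕ) by norm_num, Real.rpow_natCast, ← Real.exp_nat_mul]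
    congr 1
    push_cast
    ring
  simp only [Pi.mul_apply, e1, e2] at h2
  set X := ∫⁻ s, ENNReal.ofReal (g s ^ 2 * Real.exp (-v s)) ∂μ with hX
  set Y := ∫⁻ s, ENNReal.ofReal (Real.exp (v s)) ∂μ with hY
  have h3 : 1 ≤ X * Y := by
    have h4 : 1 ≤ (X * Y) ^ (1 / 2 : ℝ) := by
      rw [ENNReal.mul_rpow_of_nonneg _ _ (by norm_num)]
      exact h1.trans h2
    by_contra! h5
    exact absurd h4 (not_le.2 (ENNReal.rpow_lt_one h5 (by norm_num)))
  have h6 : Y⁻¹ ≤ X := by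
    rw [← one_div]
    exact ENNReal.div_le_of_le_mul h3
  refine h6.trans (lintegral_mono fun s => ENNReal.ofReal_le_ofReal ?_)
  exact mul_le_mul_of_nonneg_right (hk s) (Real.exp_pos _).le

theorem measurable_potential {L : ℝ} (hL : 0 < L) (ε : ℝ) (N : ℕ) :
    Measurable (potential L ε N) := by
  have h1 : Continuous fun x : Space N × (ℝ × ℝ) => perpField L (perpPart x.1) x.2 :=
    (continuous_perpField_uncurry L N).comp (by fun_prop : Continuous fun
      x : Space N × (ℝ × ℝ) => (perpPart x.1, x.2))
  have h2 : Continuous fun x : Space N × (ℝ × ℝ) =>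
      ((zeroCoord x.1 / L + perpField L (perpPart x.1) x.2) ^ 4 -
        6 * ε * renormConst L N * (zeroCoord x.1 / L + perpField L (perpPart x.1) x.2) ^ 2 +
        3 * ε ^ 2 * renormConst L N ^ 2) := by fun_prop
  have h3 := (h2.stronglyMeasurable.integral_prod_right' (ν := torusMeasure L)).measurable
  have h4 : potential L ε N = fun z => 1 / 2 * (-zeroCoord z ^ 2 +
        ∑ k : nonzeroModes N, eigenvalue L k.1 * perpPart z k ^ 2) +
      1 / 4 * ∫ p, ((zeroCoord z / L + perpField L (perpPart z) p) ^ 4 -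
        6 * ε * renormConst L N * (zeroCoord z / L + perpField L (perpPart z) p) ^ 2 +
        3 * ε ^ 2 * renormConst L N ^ 2) ∂torusMeasure L := funext fun z => potential_eq hL ε z
  rw [h4]
  have h5 : Continuous fun z : Space N => 1 / 2 * (-zeroCoord z ^ 2 +
        ∑ k : nonzeroModes N, eigenvalue L k.1 * perpPart z k ^ 2) := by
    fun_prop
  exact h5.measurable.add (h3.const_mul _)

/-- Dirichlet energies of admissible functions are bounded below by integrating one-dimensional
capacities over the lines parallel to the mean mode. -/
theorem lintegral_inv_le_energy {L ε δ : ℝ} (hL : 0 < L) (hδ : 0 < δ) (hδ' : δ < 1)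
    {N : ℕ} {Aperp Dperp : Set (PerpSpace N)} (hD : MeasurableSet Dperp) (hDA : Dperp ⊆ Aperp)
    {h : Space N → ℝ} {G : Space N → Space N}
    (hadm : Admissible L ε N (cylinder L δ (-1) Aperp) (cylinder L δ 1 Aperp) h G) :
    ∫⁻ w in Dperp, (∫⁻ s in Ioo (-((1 - δ) * L)) ((1 - δ) * L),
        ENNReal.ofReal (Real.exp (potential L ε N (glue (w, s)) / ε)))⁻¹ ≤
      ∫⁻ z in (cylinder L δ (-1) Aperp ∪ cylinder L δ 1 Aperp)ᶜ,
        ENNReal.ofReal (‖G z‖ ^ 2 * Real.exp (-potential L ε N z / ε)) := by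
  set a := (1 - δ) * L with ha
  set a' := (1 + δ) * L with ha'
  have ha0 : 0 < a := mul_pos (by linarith) hL
  have haa' : a < a' := by rw [ha, ha']; nlinarith
  have hcut : ∀ n : ℕ, 0 < (a' - a) / ((n : ℝ) + 1) := fun n =>
    div_pos (by linarith) (by positivity)
  choose η hη using fun n : ℕ => exists_cutoff ha0 (hcut n)
  have hweak : ∀ᵐ w, ∀ n, ∫ s, (h (glue (w, s)) * deriv (η n) s +
      zeroCoord (G (glue (w, s))) * η n s) = 0 :=
    ae_all_iff.2 fun n => ae_slice_integral_eq hadm.hasWeakGradient (hη n).1 (hη n).2.1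
  obtain ⟨hh, hG, -⟩ := hadm.hasWeakGradient
  have hG0 : LocallyIntegrable (fun z => zeroCoord (G z)) := fun z => by
    obtain ⟨u, hu, hi⟩ := hG z
    exact ⟨u, hu, (EuclideanSpace.proj (𝕜 := ℝ)
      (⟨0, zero_mem_modes N⟩ : modes N)).integrable_comp hi⟩
  have hslice1 := ae_integrableOn_slice hG0 (isCompact_Icc (a := -a') (b := a'))
  have hslice2 := ae_integrableOn_slice hh (isCompact_Icc (a := -a') (b := a'))
  have hone : ∀ᵐ w : PerpSpace N, ∀ᵐ s : ℝ,
      glue (w, s) ∈ cylinder L δ (-1) Aperp → h (glue (w, s)) = 1 := by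
    refine Measure.ae_ae_of_ae_prod
      (p := fun x : PerpSpace N × ℝ => glue x ∈ cylinder L δ (-1) Aperp → h (glue x) = 1) ?_
    exact (measurePreserving_glue N).quasiMeasurePreserving.ae hadm.eq_one
  have hzero : ∀ᵐ w : PerpSpace N, ∀ᵐ s : ℝ,
      glue (w, s) ∈ cylinder L δ 1 Aperp → h (glue (w, s)) = 0 := by
    refine Measure.ae_ae_of_ae_prod
      (p := fun x : PerpSpace N × ℝ => glue x ∈ cylinder L δ 1 Aperp → h (glue x) = 0) ?_
    exact (measurePreserving_glue N).quasiMeasurePreserving.ae hadm.eq_zero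
  have hpm := measurable_potential hL ε N
  have hpt : ∀ᵐ w, w ∈ Dperp → (∫⁻ s in Ioo (-a) a,
        ENNReal.ofReal (Real.exp (potential L ε N (glue (w, s)) / ε)))⁻¹ ≤
      ∫⁻ s in Ioo (-a) a, ENNReal.ofReal (‖G (glue (w, s))‖ ^ 2 *
        Real.exp (-(potential L ε N (glue (w, s)) / ε))) := by
    filter_upwards [hweak, hslice1, hslice2, hone, hzero] with w hw1 hw2 hw3 hw4 hw5 hwD
    have hgi := integral_weakDeriv_eq_neg_one ha0 haa' hw2 hw3
      (by
        filter_upwards [hw4] with s hs hsI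
        refine hs ⟨?_, by simpa using hDA hwD⟩
        rw [zeroCoord_glue, mem_Icc, le_div_iff₀ hL, div_le_iff₀ hL]
        rw [ha, ha', mem_Icc] at hsI
        constructor <;> linarith [hsI.1, hsI.2])
      (by
        filter_upwards [hw5] with s hs hsI
        refine hs ⟨?_, by simpa using hDA hwD⟩
        rw [zeroCoord_glue, mem_Icc, le_div_iff₀ hL, div_le_iff₀ hL]
        rw [ha, ha', mem_Icc] at hsI
        constructor <;> linarith [hsI.1, hsI.2]) hη hw1
    refine inv_lintegral_exp_le hgi (v := fun s => potential L ε N (glue (w, s)) / ε) ?_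
      (k := fun s => ‖G (glue (w, s))‖ ^ 2) fun s => ?_
    · have : Measurable fun s : ℝ => glue (w, s) :=
        ((continuous_glue N).comp (by fun_prop)).measurable
      exact (hpm.comp this).div_const _
    · rw [← sq_abs]
      gcongr
      exact PiLp.norm_apply_le (G (glue (w, s))) ⟨0, zero_mem_modes N⟩
  set f : Space N → ℝ≥0∞ := fun z => ENNReal.ofReal (‖G z‖ ^ 2 *
    Real.exp (-potential L ε N z / ε)) with hf
  have hfm : AEMeasurable f := by
    have h1 := hG.aestronglyMeasurable.norm.aemeasurable
    have h2 : Measurable fun z => Real.exp (-potential L ε N z / ε) := by fun_prop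
    exact ((h1.pow_const 2).mul h2.aemeasurable).ennreal_ofReal
  have hsub : glue '' (Dperp ×ˢ Ioo (-a) a) ⊆
      (cylinder L δ (-1) Aperp ∪ cylinder L δ 1 Aperp)ᶜ := by
    rintro _ ⟨⟨w, s⟩, ⟨-, hs⟩, rfl⟩ (h' | h')
    · have := h'.1.2
      rw [zeroCoord_glue, div_le_iff₀ hL] at this
      have h3 := hs.1
      simp only [ha] at h3
      linarith
    · have := h'.1.1
      rw [zeroCoord_glue, le_div_iff₀ hL] at this
      have h3 := hs.2
      simp only [ha] at h3
      linarith
  calc _ ≤ ∫⁻ w in Dperp, ∫⁻ s in Ioo (-a) a, f (glue (w, s)) := by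
        refine lintegral_mono_ae ((ae_restrict_iff' hD).2 ?_)
        filter_upwards [hpt] with w hw hwD
        simpa only [hf, neg_div] using hw hwD
    _ = ∫⁻ x in Dperp ×ˢ Ioo (-a) a, f (glue x) := by
        rw [Measure.volume_eq_prod, ← Measure.prod_restrict, lintegral_prod]
        have : AEMeasurable (fun x : PerpSpace N × ℝ => f (glue x)) :=
          hfm.comp_quasiMeasurePreserving (measurePreserving_glue N).quasiMeasurePreserving
        rw [Measure.prod_restrict]
        exact this.restrict
    _ = ∫⁻ z in glue '' (Dperp ×ˢ Ioo (-a) a), f z := by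
        rw [← (measurePreserving_glue N).setLIntegral_comp_preimage_emb (measurableEmbedding_glue N),
          preimage_image_eq _ (measurableEmbedding_glue N).injective]
    _ ≤ _ := lintegral_mono_set hsub

/-! ### Rescaling and averaging over the transversal Gaussian measure -/

theorem setLIntegral_comp_smul {E : Type*} [NormedAddCommGroup E] [NormedSpace ℝ E]
    [MeasurableSpace E] [BorelSpace E] [FiniteDimensional ℝ E] (μ : Measure E)
    [μ.IsAddHaarMeasure] {r : ℝ} (hr : 0 < r) (f : E → ℝ≥0∞) (s : Set E) :
    ∫⁻ x in s, f x ∂μ = ENNReal.ofReal (r ^ Module.finrank ℝ E) *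
      ∫⁻ y in (fun y => r • y) ⁻¹' s, f (r • y) ∂μ := by
  have he : MeasurableEmbedding fun y : E => r • y :=
    (Homeomorph.smulOfNeZero r hr.ne').measurableEmbedding
  have h1 : ∫⁻ y in (fun y => r • y) ⁻¹' s, f (r • y) ∂μ =
      ENNReal.ofReal (r ^ Module.finrank ℝ E)⁻¹ * ∫⁻ x in s, f x ∂μ := by
    rw [← he.lintegral_map (μ := μ.restrict ((fun y => r • y) ⁻¹' s)), ← he.restrict_map,
      Measure.map_addHaar_smul μ hr.ne', Measure.restrict_smul, lintegral_smul_measure,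
      abs_of_pos (by positivity), smul_eq_mul]
  rw [h1, ← mul_assoc, ← ENNReal.ofReal_mul (by positivity),
    mul_inv_cancel₀ (by positivity), ENNReal.ofReal_one, one_mul]

theorem ofReal_integral_le_lintegral {α : Type*} [MeasurableSpace α] {μ : Measure α} {f : α → ℝ}
    (hf : Integrable f μ) : ENNReal.ofReal (∫ x, f x ∂μ) ≤ ∫⁻ x, ENNReal.ofReal (f x) ∂μ := by
  calc _ ≤ ENNReal.ofReal (∫ x, max (f x) 0 ∂μ) :=
        ENNReal.ofReal_le_ofReal (integral_mono hf hf.pos_part fun x => le_max_left _ _)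
    _ = ∫⁻ x, ENNReal.ofReal (max (f x) 0) ∂μ :=
        ofReal_integral_eq_lintegral_ofReal hf.pos_part
          (Eventually.of_forall fun x => le_max_right _ _)
    _ = _ := by simp

theorem wickError_nonneg (L : ℝ) {N : ℕ} (y : PerpSpace N) : 0 ≤ wickError L y := by
  unfold wickError; positivity

theorem exists_expectation_wickError_le {L : ℝ} (hL : 0 < L) (hL' : L < 2 * Real.pi) :
    ∃ K : ℝ, 0 ≤ K ∧ ∀ N, Integrable (fun y : PerpSpace N => wickError L y) (perpGaussian L N) ∧
      ∫ y : PerpSpace N, wickError L y ∂perpGaussian L N ≤ K := by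
  obtain ⟨K, hK, h⟩ := exists_wick_second_moments hL hL'
  refine ⟨1 + 3 * K, by positivity, fun N => ?_⟩
  have := isProbabilityMeasure_perpGaussian hL hL' N
  obtain ⟨i2, e2⟩ := h N _ (mem_insert _ _)
  obtain ⟨i3, e3⟩ := h N _ (mem_insert_of_mem _ (mem_insert _ _))
  obtain ⟨i4, e4⟩ := h N _ (mem_insert_of_mem _ (mem_insert_of_mem _ rfl))
  have i1 : Integrable (fun _ : PerpSpace N => (1 : ℝ)) (perpGaussian L N) := integrable_const _
  have j2 := i1.fun_add i2
  have j3 := j2.fun_add i3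
  refine ⟨j3.fun_add i4, ?_⟩
  simp only [wickError, wickInt₂, wickInt₃, wickInt₄]
  rw [integral_add j3 i4, integral_add j2 i3, integral_add i1 i2]
  simp only [integral_const, probReal_univ, smul_eq_mul]
  linarith

/-- The average over `D` of the pointwise bound on the effective transversal density. -/
theorem ofReal_le_lintegral_one_sub_wickError {L : ℝ} (hL : 0 < L) (hL' : L < 2 * Real.pi)
    {N : ℕ} {x M : ℝ} (hx : 0 ≤ x)
    (hi : Integrable (fun y : PerpSpace N => wickError L y) (perpGaussian L N))
    (hM : ∫ y : PerpSpace N, wickError L y ∂perpGaussian L N ≤ M) (D : Set (PerpSpace N)) :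
    ENNReal.ofReal ((perpGaussian L N).real D - x * M) ≤
      ∫⁻ y in D, ENNReal.ofReal (1 - x * wickError L y) ∂perpGaussian L N := by
  have := isProbabilityMeasure_perpGaussian hL hL' N
  have i1 : Integrable (fun y : PerpSpace N => 1 - x * wickError L y)
      ((perpGaussian L N).restrict D) :=
    (integrable_const _).sub (hi.restrict.const_mul x)
  refine le_trans (ENNReal.ofReal_le_ofReal ?_) (ofReal_integral_le_lintegral i1)
  rw [integral_sub (integrable_const _) (hi.restrict.const_mul x), integral_const_mul]
  have h1 : ∫ y in D, wickError L y ∂perpGaussian L N ≤ M :=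
    (setIntegral_le_integral hi (Eventually.of_forall fun y => wickError_nonneg L y)).trans hM
  have h2 := mul_le_mul_of_nonneg_left h1 hx
  simp only [integral_const, measureReal_restrict_apply_univ, smul_eq_mul, mul_one]
  linarith

theorem prod_sqrt_scaled {L ε : ℝ} (hε : 0 < ε) (N : ℕ) :
    ∏ k : nonzeroModes N, √(2 * Real.pi * ε / eigenvalue L k.1) =
      √ε ^ Module.finrank ℝ (PerpSpace N) *
        ∏ k : nonzeroModes N, √(2 * Real.pi / eigenvalue L k.1) := by
  rw [finrank_euclideanSpace, ← Finset.card_univ, ← Finset.prod_const, ← Finset.prod_mul_distrib]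
  refine Finset.prod_congr rfl fun k _ => ?_
  rw [← Real.sqrt_mul hε.le]
  congr 1
  ring

/-- The integral over the transversal coordinates of the one-dimensional capacities, in rescaled
coordinates. -/
theorem le_lintegral_inv_partition {L ε K δ M : ℝ} (hL : 0 < L) (hL' : L < 2 * Real.pi)
    (hε : 0 < ε) (hK : 0 ≤ K) (hδ : 0 < δ) {N : ℕ}
    (hpart : ∀ (y : PerpSpace N) (s : Set ℝ),
      (∀ t ∈ s, ε * t ^ 2 ≤ L ^ 2) → MeasurableSet s → ∀ E : ℝ,
      ENNReal.ofReal ((√(2 * Real.pi))⁻¹ * Real.exp (-E) * (1 - ε * (K * wickError L y))) ≤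
        (∫⁻ t in s, ENNReal.ofReal (Real.exp (-(t ^ 2 / 2) + E +
          ε * (meanInteraction L (wickInt₂ L y - 1) (wickInt₃ L y) t +
            (wickInt₄ L y - 6 / L ^ 2 * wickInt₂ L y + 3 / L ^ 2) / 4))))⁻¹)
    (hi : Integrable (fun y : PerpSpace N => wickError L y) (perpGaussian L N))
    (hM : ∫ y : PerpSpace N, wickError L y ∂perpGaussian L N ≤ M)
    {D : Set (PerpSpace N)} (hD : MeasurableSet D) :
    ENNReal.ofReal (√(ε * |eigenvalue L 0| / (2 * Real.pi)) *
        (∏ k : nonzeroModes N, √(2 * Real.pi * ε / eigenvalue L k.1)) *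
        ((perpGaussian L N).real ((√ε)⁻¹ • D) - ε * K * M)) ≤
      ENNReal.ofReal ε * ∫⁻ w in D, (∫⁻ s in Ioo (-((1 - δ) * L)) ((1 - δ) * L),
        ENNReal.ofReal (Real.exp (potential L ε N (glue (w, s)) / ε)))⁻¹ := by
  have hsε : 0 < √ε := Real.sqrt_pos.2 hε
  have hs2 : √ε ^ 2 = ε := Real.sq_sqrt hε.le
  have hpi := Real.pi_pos
  have h2π : 0 < √(2 * Real.pi) := by positivity
  set n := Module.finrank ℝ (PerpSpace N) with hn
  set r := ∏ k : nonzeroModes N, √(2 * Real.pi / eigenvalue L k.1) with hr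
  have hr0 : 0 < r := Finset.prod_pos fun k _ => Real.sqrt_pos.2
    (div_pos (by positivity) (eigenvalue_pos hL hL' (ne_zero_of_nonzeroModes k)))
  set s := (fun t : ℝ => √ε • t) ⁻¹' Ioo (-((1 - δ) * L)) ((1 - δ) * L) with hs
  have hsm : MeasurableSet s := measurableSet_Ioo.preimage (by fun_prop)
  have hst : ∀ t ∈ s, ε * t ^ 2 ≤ L ^ 2 := by
    intro t ht
    rw [hs, mem_preimage, smul_eq_mul, mem_Ioo] at ht
    have h1 : |√ε * t| ≤ L := by
      rw [abs_le]
      constructor <;> nlinarith [ht.1, ht.2]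
    have h2 : (√ε * t) ^ 2 ≤ L ^ 2 := sq_le_sq' (abs_le.1 h1).1 (abs_le.1 h1).2
    rwa [mul_pow, hs2] at h2
  have hDset : (fun y : PerpSpace N => √ε • y) ⁻¹' D = (√ε)⁻¹ • D :=
    preimage_smul₀ hsε.ne' D
  have hDm : MeasurableSet ((√ε)⁻¹ • D) := hD.const_smul_of_ne_zero (inv_ne_zero hsε.ne')
  set d : PerpSpace N → ℝ := fun y => r⁻¹ *
    Real.exp (-(1 / 2 * ∑ k : nonzeroModes N, eigenvalue L k.1 * y k ^ 2)) with hd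
  have hdm : Measurable fun y => ENNReal.ofReal (d y) := by
    have : Continuous d := by rw [hd]; fun_prop
    exact this.measurable.ennreal_ofReal
  have hpt : ∀ y : PerpSpace N, ENNReal.ofReal ((√ε)⁻¹ * (√(2 * Real.pi))⁻¹ * r) *
      (ENNReal.ofReal (d y) * ENNReal.ofReal (1 - ε * K * wickError L y)) ≤
      (∫⁻ s in Ioo (-((1 - δ) * L)) ((1 - δ) * L),
        ENNReal.ofReal (Real.exp (potential L ε N (glue (√ε • y, s)) / ε)))⁻¹ := by
    intro y
    have hV : ∀ t : ℝ, potential L ε N (glue (√ε • y, √ε • t)) / ε = _ := fun t =>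
      potential_div_eq hL hL' hε (z := glue (√ε • y, √ε • t)) (t := t) (y := y) (by simp) (by simp)
    rw [setLIntegral_comp_smul volume hsε]
    simp only [hV, Module.finrank_self, pow_one]
    rw [ENNReal.mul_inv (Or.inl (by simpa using hsε)) (Or.inl ENNReal.ofReal_ne_top),
      ← ENNReal.ofReal_inv_of_pos hsε]
    refine le_trans (le_of_eq ?_) (mul_le_mul_right (hpart y s hst hsm _) _)
    rw [← ENNReal.ofReal_mul (by positivity), ← ENNReal.ofReal_mul (by positivity),
      ← ENNReal.ofReal_mul (by positivity)]
    congr 1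
    simp only [hd]
    field_simp
  calc _ = ENNReal.ofReal ε * (ENNReal.ofReal (√ε ^ n) *
          (ENNReal.ofReal ((√ε)⁻¹ * (√(2 * Real.pi))⁻¹ * r) *
            ENNReal.ofReal ((perpGaussian L N).real ((√ε)⁻¹ • D) - ε * K * M))) := by
        rw [← ENNReal.ofReal_mul (by positivity), ← ENNReal.ofReal_mul (by positivity),
          ← ENNReal.ofReal_mul (by positivity), prod_sqrt_scaled hε]
        congr 1
        have h0 : |eigenvalue L 0| = 1 := by simp [eigenvalue]
        rw [h0, mul_one, Real.sqrt_div hε.le]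
        have : ε * (√ε)⁻¹ = √ε := by field_simp; exact hs2.symm
        calc _ = (ε * (√ε)⁻¹) / √(2 * Real.pi) * (√ε ^ n * r) *
              ((perpGaussian L N).real ((√ε)⁻¹ • D) - ε * K * M) := by rw [this]
          _ = _ := by ring
    _ ≤ ENNReal.ofReal ε * (ENNReal.ofReal (√ε ^ n) *
          (ENNReal.ofReal ((√ε)⁻¹ * (√(2 * Real.pi))⁻¹ * r) *
            ∫⁻ y in (√ε)⁻¹ • D, ENNReal.ofReal (1 - ε * K * wickError L y) ∂perpGaussian L N)) := by
        gcongr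
        exact ofReal_le_lintegral_one_sub_wickError hL hL' (by positivity) hi hM _
    _ = ENNReal.ofReal ε * (ENNReal.ofReal (√ε ^ n) *
          ∫⁻ y in (√ε)⁻¹ • D, ENNReal.ofReal ((√ε)⁻¹ * (√(2 * Real.pi))⁻¹ * r) *
            (ENNReal.ofReal (d y) * ENNReal.ofReal (1 - ε * K * wickError L y))) := by
        rw [lintegral_const_mul' _ _ ENNReal.ofReal_ne_top, perpGaussian,
          setLIntegral_withDensity_eq_setLIntegral_mul_non_measurable _ hdm _ hDm
            (Eventually.of_forall fun y => ENNReal.ofReal_lt_top)]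
        rfl
    _ ≤ ENNReal.ofReal ε * (ENNReal.ofReal (√ε ^ n) *
          ∫⁻ y in (√ε)⁻¹ • D, (∫⁻ s in Ioo (-((1 - δ) * L)) ((1 - δ) * L),
            ENNReal.ofReal (Real.exp (potential L ε N (glue (√ε • y, s)) / ε)))⁻¹) := by
        gcongr with y
        exact hpt y
    _ = _ := by rw [setLIntegral_comp_smul volume hsε (s := D), hDset]

end AllenCahn

open AllenCahn in
theorem proposition5p6 (L : ℝ) (hL : 0 < L) (hL' : L < 2 * Real.pi)
    (δ : ℝ) (hδ : 0 < δ) (hδ' : δ < 1) :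
    ∃ c : ℝ, 0 < c ∧
      ∀ (ε : ℝ), 0 < ε → ∀ (N : ℕ) (Aperp Dperp : Set (AllenCahn.PerpSpace N)),
        MeasurableSet Aperp → MeasurableSet Dperp → Dperp ⊆ Aperp →
        ENNReal.ofReal
            (√(ε * |AllenCahn.eigenvalue L 0| / (2 * Real.pi)) *
              (∏ k : AllenCahn.nonzeroModes N,
                √(2 * Real.pi * ε / AllenCahn.eigenvalue L k.1)) *
              ((AllenCahn.perpGaussian L N).real ((√ε)⁻¹ • Dperp) - c * √ε)) ≤
          AllenCahn.capacity L ε N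
            (AllenCahn.cylinder L δ (-1) Aperp) (AllenCahn.cylinder L δ 1 Aperp) := by
  obtain ⟨K, hK, hpart⟩ := exists_le_inv_partition hL
  obtain ⟨M, hM, hE⟩ := exists_expectation_wickError_le hL hL'
  refine ⟨1 + K * M, by positivity, ?_⟩
  intro ε hε N Aperp Dperp _ hD hDA
  have := isProbabilityMeasure_perpGaussian hL hL' N
  have hKM : 0 ≤ K * M := by positivity
  rcases le_total ε 1 with hε1 | hε1
  · -- For `ε ≤ 1` the error `ε K M` is at most `(1 + K M) √ε`.
    have hsq : √ε ≤ 1 := Real.sqrt_le_one.2 hε1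
    have hs2 : √ε * √ε = ε := Real.mul_self_sqrt hε.le
    refine le_trans (ENNReal.ofReal_le_ofReal ?_) ((le_lintegral_inv_partition hL hL' hε hK hδ
      (hpart ε hε hε1 N) (hE N).1 (hE N).2 hD).trans ?_)
    · refine mul_le_mul_of_nonneg_left ?_ (by positivity)
      have h1 : ε ≤ √ε := by nlinarith [Real.sqrt_nonneg ε]
      have h2 := mul_le_mul_of_nonneg_right h1 hKM
      have h3 := Real.sqrt_nonneg ε
      linarith
    · refine mul_le_mul_right (le_iInf fun h => le_iInf fun G => le_iInf fun hadm => ?_) _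
      exact lintegral_inv_le_energy hL hδ hδ' hD hDA hadm
  · -- For `ε ≥ 1` the lower bound is not positive.
    have h1 : (1 : ℝ) ≤ √ε := Real.one_le_sqrt.2 hε1
    have h2 : (perpGaussian L N).real ((√ε)⁻¹ • Dperp) ≤ 1 := measureReal_le_one
    rw [ENNReal.ofReal_of_nonpos]
    · exact zero_le
    · refine mul_nonpos_of_nonneg_of_nonpos (by positivity) ?_
      nlinarith
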